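/- Let $\mathbb T=[0,2\pi]$ be the flat torus, let $m_0>0$, $\phi_0(\theta)=-m_0\cos\theta$, $e_0(\theta,v)=\frac{v^2}{2}+\phi_0(\theta)$ and $f_0(\theta,v)=F(e_0(\theta,v))$ on $\mathbb T\times\mathbb R$. Assume that $F:\mathbb R\to\mathbb R$ is continuous and that, for some $e_*\in\mathbb R\cup\{+\infty\}$, $F$ is $\mathcal C^1$ on $(-\infty,e_*)$ with $F'<0$ there; that $F(e)=0$ for $e\ge e_*$ if $e_*<+\infty$, and $\lim_{e\to+\infty}F(e)=0$ if $e_*=+\infty$; that $f_0\in L^1((1+v^2)\,d\theta\,dv)$; that, in the case $e_*=m_0$, $\log(m_0-e)F'(e)$ is integrable on $(-m_0,m_0)$; and that $f_0$ is a steady state of the HMF model, i.e. $\phi_0$ is the potential generated by $f_0$: $$-\int_0^{2\pi}\Big(\int_{\mathbb R}f_0(\theta',v)\,dv\Big)\cos(\theta-\theta')\,d\theta'=-m_0\cos\theta\qquad\text{for all }\theta .$$ Let $f_0^\sharp(s)=\inf\{t\ge 0:\ |\{(\theta,v)\in\mathbb T\times\mathbb R: f_0(\theta,v)>t\}|\le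 s\}$ for $s\ge0$. For a potential $\phi$ on $\mathbb T$ let $a_\phi(e)=|\{(\theta,v)\in\mathbb T\times\mathbb R:\frac{v^2}{2}+\phi(\theta)<e\}|$ and $f_0^{*\phi}(\theta,v)=f_0^\sharp\big(a_\phi(\frac{v^2}{2}+\phi(\theta))\big)$. The reduced energy is $$\mathcal J(m)=\frac{m^2}{2}+\int_{-\infty}^{+\infty}\!\int_0^{2\pi}\Big(\frac{v^2}{2}+\phi(\theta)\Big)f_0^{*\phi}(\theta,v)\,d\theta\,dv,\qquad \phi(\theta)=-m\cos\theta,\quad m\ge 0 .$$ Let $$\kappa_0=\int_0^{2\pi}\!\!\int_{-\infty}^{+\infty}|F'(e_0(\theta,v))|\left(\frac{\int_{\mathcal D}(\cos\theta-\cos\theta')(e_0(\theta,v)-\phi_0(\theta'))^{-1/2}d\theta'}{\int_{\mathcal D}(e_0(\theta,v)-\phi_0(\theta'))^{-1/2}d\theta'}\right)^2 dv\,d\theta\in[0,+\infty],$$ where $\mathcal D=\mathcal D(\theta,v)=\{\theta'\in\mathbb T:\phi_0(\theta')<e_0(\theta,v)\}$. If $\kappa_0<1$, then the integral defining $\mathcal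 J(m)$ converges absolutely for every $m\ge0$, $m_0$ is a strict local minimizer of $\mathcal J$, $\mathcal J$ is differentiable in a neighbourhood of $m_0$ and twice differentiable at $m_0$, and $$\mathcal J'(m_0)=0,\qquad \mathcal J''(m_0)=1-\kappa_0>0 .$$ -/

import Mathlib

open MeasureTheory

namespace HMF

/-- Lebesgue measure `dθ dv` on the phase space `𝕋 × ℝ`, where `𝕋 = [0, 2π]`. -/
noncomputable def phase : Measure (ℝ × ℝ) :=
  (volume.restrict (Set.Icc (0 : ℝ) (2 * Real.pi))).prod volume

/-- The density `ρ_f(θ) = ∫ f(θ, v) dv`. -/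
noncomputable def density (f : ℝ × ℝ → ℝ) (θ : ℝ) : ℝ := ∫ v : ℝ, f (θ, v)

/-- The self-consistent potential `φ_f(θ) = - ∫_0^{2π} ρ_f(θ') cos (θ - θ') dθ'`. -/
noncomputable def potential (f : ℝ × ℝ → ℝ) (θ : ℝ) : ℝ :=
  -∫ θ' in Set.Icc (0 : ℝ) (2 * Real.pi), density f θ' * Real.cos (θ - θ')

/-- The potential `θ ↦ - m cos θ`. -/
noncomputable def cosPotential (m θ : ℝ) : ℝ := -(m * Real.cos θ)

/-- The microscopic energy `v² / 2 + φ(θ)`. -/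
noncomputable def energy (φ : ℝ → ℝ) (p : ℝ × ℝ) : ℝ := p.2 ^ 2 / 2 + φ p.1

/-- The distribution function `μ_f(t) = |{(θ, v) : f(θ, v) > t}|`, possibly infinite. -/
noncomputable def distrib (f : ℝ × ℝ → ℝ) (t : ℝ) : ENNReal := phase {p | t < f p}

/-- The pseudo-inverse `f^♯(s) = inf {t ≥ 0 : μ_f(t) ≤ s}` of `μ_f`. It is used for bounded
functions only, for which the set is nonempty for every `s ≥ 0`. -/
noncomputable def sharp (f : ℝ × ℝ → ℝ) (s : ℝ) : ℝ :=
  sInf {t : ℝ | 0 ≤ t ∧ distrib f t ≤ ENNReal.ofReal s}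

/-- `a_φ(e) = |{(θ, v) : v² / 2 + φ(θ) < e}|`, finite for continuous `φ`. -/
noncomputable def sublevelArea (φ : ℝ → ℝ) (e : ℝ) : ℝ := (phase {p | energy φ p < e}).toReal

/-- The rearrangement of `f` with respect to the microscopic energy,
`f^{*φ}(θ, v) = f^♯(a_φ(v² / 2 + φ(θ)))`. -/
noncomputable def rearrangement (f : ℝ × ℝ → ℝ) (φ : ℝ → ℝ) (p : ℝ × ℝ) : ℝ :=
  sharp f (sublevelArea φ (energy φ p))

/-- The integrand `(v² / 2 + φ(θ)) f₀^{*φ}(θ, v)`, with `φ(θ) = - m cos θ`, of the reduced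
energy. -/
noncomputable def reducedEnergyIntegrand (f₀ : ℝ × ℝ → ℝ) (m : ℝ) (p : ℝ × ℝ) : ℝ :=
  energy (cosPotential m) p * rearrangement f₀ (cosPotential m) p

/-- The reduced energy
`J(m) = m² / 2 + ∬ (v² / 2 + φ(θ)) f₀^{*φ}(θ, v) dθ dv`, with `φ(θ) = - m cos θ`. -/
noncomputable def reducedEnergy (f₀ : ℝ × ℝ → ℝ) (m : ℝ) : ℝ :=
  m ^ 2 / 2 + ∫ p, reducedEnergyIntegrand f₀ m p ∂phase

/-- `f₀(θ, v) = F(v² / 2 - m₀ cos θ)`. -/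
noncomputable def steadyState (F : ℝ → ℝ) (m₀ : ℝ) (p : ℝ × ℝ) : ℝ :=
  F (energy (cosPotential m₀) p)

/-- The standing assumptions on the profile `F`, the cut-off energy `e_* ∈ ℝ ∪ {+∞}` and the
magnetization `m₀ > 0` of the steady state `f₀(θ, v) = F(v² / 2 - m₀ cos θ)`. -/
structure IsSteadyState (F : ℝ → ℝ) (eStar : EReal) (m₀ : ℝ) : Prop where
  eStar_ne_bot : eStar ≠ ⊥
  continuous : Continuous F
  contDiffOn : ContDiffOn ℝ 1 F {e : ℝ | (e : EReal) < eStar}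
  deriv_neg : ∀ e : ℝ, (e : EReal) < eStar → deriv F e < 0
  eq_zero : ∀ e : ℝ, eStar ≤ (e : EReal) → F e = 0
  tendsto_zero : eStar = ⊤ → Filter.Tendsto F Filter.atTop (nhds 0)
  /-- `f₀` belongs to `L¹((1 + v²) dθ dv)`. -/
  energy_space : Integrable (fun p : ℝ × ℝ => (1 + p.2 ^ 2) * steadyState F m₀ p) phase
  /-- The integrability condition for the critical case `e_* = m₀`. -/
  log_integrable : eStar = (m₀ : EReal) →
    IntegrableOn (fun e : ℝ => Real.log (m₀ - e) * deriv F e) (Set.Ioo (-m₀) m₀)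
  m₀_pos : 0 < m₀
  /-- The potential generated by `f₀` is `φ₀(θ) = - m₀ cos θ`. -/
  self_consistent : ∀ θ : ℝ, potential (steadyState F m₀) θ = cosPotential m₀ θ

/-- `𝒟 = {θ' ∈ 𝕋 : φ(θ') < e}`. -/
def accessible (φ : ℝ → ℝ) (e : ℝ) : Set ℝ :=
  {θ' : ℝ | θ' ∈ Set.Icc (0 : ℝ) (2 * Real.pi) ∧ φ θ' < e}

/-- The quotient of
`∫_𝒟 (cos θ - cos θ') (e - φ(θ'))^{-1/2} dθ'` by `∫_𝒟 (e - φ(θ'))^{-1/2} dθ'`. -/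
noncomputable def cosDeviation (φ : ℝ → ℝ) (θ e : ℝ) : ℝ :=
  (∫ θ' in accessible φ e, (Real.cos θ - Real.cos θ') * (e - φ θ') ^ (-(1 / 2) : ℝ)) /
    ∫ θ' in accessible φ e, (e - φ θ') ^ (-(1 / 2) : ℝ)

/-- The number `κ₀`, an integral of a nonnegative function and hence a priori in `[0, ∞]`. -/
noncomputable def kappa (F : ℝ → ℝ) (m₀ : ℝ) : ENNReal :=
  ∫⁻ p, ENNReal.ofReal
    (|deriv F (energy (cosPotential m₀) p)| *
      cosDeviation (cosPotential m₀) p.1 (energy (cosPotential m₀) p) ^ 2) ∂phase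

end HMF

/-! Rescaling velocities by `√m` and energies by `m` turns every potential `-m cos` with `m > 0`
into the pendulum potential `-cos`, and a sublevel set of positive area is determined by that area.
Since `F` decreases to zero, `F e` is the mass of `(e, ∞)` under `dμ = |F'(η)| dη`. The
rearrangement of `f₀` at a point is then the `μ`-mass of those `η` whose sublevel set `{e₀ < η}` has
larger area than the sublevel set through that point. Fubini (`layer_cake`) gives `J(m) = m² / 2 + ∫
E(s(η), m) dμ(η)`, where `s(η)` is the area of `{e₀ < η}` and `E(s, m)` is the energy integrated
over the sublevel set of area `s` for `-m cos`.

At fixed area the motion of the boundary does not contribute to first order, so `∂E/∂m = -C`, with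
`C(s, m)` the integral of `cos` over that set (`hasDerivAt_energyProfile`). Also `∂C/∂m = V / √m`,
with `V` the unnormalized variance of `cos` on the bounding level set (`hasDerivAt_cosProfile`).
Hence `J'(m) = m - ∫ C dμ`, which vanishes at `m₀` by self-consistency, and `J''(m₀) = 1 - ∫ V(η /
m₀) / √m₀ dμ`. The last integral is `κ₀`: the quotient in its definition is `cos θ` minus its mean
on the level set, and taking the energy as variable in place of `v` produces `V` (`kappa_eq`).

Differentiation under the integral is the analytic point. For `J'` the bound `|C| ≤ s` suffices, as
`s(η)` is `μ`-integrable. For `J''` the periods diverge at the separatrix `x = 1`, but `V ≤ 8π`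
throughout (`cosVariance_le`). Thus `C` is Lipschitz in `m` uniformly in `η`, and the one energy `η
= m₀` at which differentiability is not available is null. -/

open MeasureTheory

namespace HMF

/-! ### Area and period integrals of the pendulum -/

/-- The speed `√(2 (x + cos θ))` of a particle of energy `x` in the potential `-cos`, extended by
zero outside the accessible region. -/
noncomputable def speed (x θ : ℝ) : ℝ := √(2 * (x + Real.cos θ))

/-- The integral of `h` over the sublevel set `{v² / 2 - cos θ < x}`. -/
noncomputable def weightedArea (h : ℝ → ℝ) (x : ℝ) : ℝ :=
  ∫ θ in (0 : ℝ)..(2 * Real.pi), h θ * (2 * speed x θ)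

/-- The derivative of `weightedArea h`, the integral of `h` with respect to the invariant measure
of the level set of energy `x`. -/
noncomputable def weightedPeriod (h : ℝ → ℝ) (x : ℝ) : ℝ :=
  ∫ θ in (0 : ℝ)..(2 * Real.pi), h θ * (2 / speed x θ)

lemma continuous_speed : Continuous (fun q : ℝ × ℝ => speed q.1 q.2) := by
  unfold speed; fun_prop

lemma speed_nonneg (x θ : ℝ) : 0 ≤ speed x θ := Real.sqrt_nonneg _

lemma speed_mono {x y : ℝ} (h : x ≤ y) (θ : ℝ) : speed x θ ≤ speed y θ :=
  Real.sqrt_le_sqrt (by linarith)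

lemma sq_speed {x θ : ℝ} (h : 0 ≤ x + Real.cos θ) : speed x θ ^ 2 = 2 * (x + Real.cos θ) :=
  Real.sq_sqrt (by linarith)

lemma speed_eq_zero {x θ : ℝ} (h : x + Real.cos θ ≤ 0) : speed x θ = 0 :=
  Real.sqrt_eq_zero_of_nonpos (by linarith)

lemma speed_pos {x θ : ℝ} (h : 0 < x + Real.cos θ) : 0 < speed x θ :=
  Real.sqrt_pos.2 (by linarith)

lemma hasDerivAt_speed {x θ : ℝ} (h : x ≠ -Real.cos θ) :
    HasDerivAt (fun y => 2 * speed y θ) (2 / speed x θ) x := by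
  rcases lt_or_gt_of_ne h with h | h
  -- Below the turning energy the speed is locally zero, and the convention `2 / 0 = 0` gives the
  -- matching derivative.
  · rw [speed_eq_zero (by linarith), div_zero]
    refine (hasDerivAt_const x (0 : ℝ)).congr_of_eventuallyEq ?_
    filter_upwards [gt_mem_nhds h] with y hy
    rw [speed_eq_zero (by linarith), mul_zero]
  · have hp : 0 < 2 * (x + Real.cos θ) := by linarith
    have h1 : HasDerivAt (fun y : ℝ => 2 * (y + Real.cos θ)) 2 x := by
      simpa using ((hasDerivAt_id x).add_const (Real.cos θ)).const_mul 2
    have h2 := (h1.sqrt hp.ne').const_mul 2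
    refine h2.congr_deriv ?_
    unfold speed
    field_simp

/-- The singularity at the turning energy `-cos θ` is integrable because `2 / speed` is the
nonnegative derivative of a continuous function. Splitting the interval there places it at an
endpoint, where no derivative is needed. -/
lemma intervalIntegrable_inv_speed (θ a b : ℝ) :
    IntervalIntegrable (fun y => 2 / speed y θ) volume a b := by
  have hc : Continuous (fun y => 2 * speed y θ) := by unfold speed; fun_prop
  have key : ∀ c, IntervalIntegrable (fun y => 2 / speed y θ) volume (-Real.cos θ) c := by
    intro c
    refine intervalIntegral.intervalIntegrable_deriv_of_nonneg (g := fun y => 2 * speed y θ)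
      hc.continuousOn (fun x hx => hasDerivAt_speed ?_)
      (fun x _ => div_nonneg zero_le_two (speed_nonneg _ _))
    rintro rfl
    rcases le_total (-Real.cos θ) c with h | h <;> simp [h] at hx
  exact (key a).symm.trans (key b)

lemma integral_inv_speed (θ a b : ℝ) :
    ∫ y in a..b, 2 / speed y θ = 2 * speed b θ - 2 * speed a θ := by
  have hc : Continuous (fun y => 2 * speed y θ) := by unfold speed; fun_prop
  exact integral_eq_of_hasDerivAt_off_countable (fun y => 2 * speed y θ) _
    (Set.countable_singleton (-Real.cos θ)) hc.continuousOn
    (fun x hx => hasDerivAt_speed hx.2) (intervalIntegrable_inv_speed θ a b)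

lemma continuous_weightedArea {h : ℝ → ℝ} (hh : Continuous h) : Continuous (weightedArea h) := by
  refine intervalIntegral.continuous_parametric_intervalIntegral_of_continuous' ?_ _ _
  unfold Function.uncurry speed
  fun_prop

lemma measurable_speed : Measurable (fun q : ℝ × ℝ => speed q.1 q.2) :=
  continuous_speed.measurable

/-- Integrating in the energy first leaves a difference of speeds, continuous in `θ`, so energy
ranges crossing the separatrix need no separate estimate. -/
lemma integrable_prod_period {h : ℝ → ℝ} (hh : Continuous h) {a b : ℝ} (hab : a ≤ b) :
    Integrable (Function.uncurry fun θ y => h θ * (2 / speed y θ))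
      ((volume.restrict (Set.Ioc 0 (2 * Real.pi))).prod (volume.restrict (Set.Ioc a b))) := by
  have hm : Measurable (Function.uncurry fun θ y => h θ * (2 / speed y θ)) := by
    refine (hh.measurable.comp measurable_fst).mul (measurable_const.div ?_)
    exact measurable_speed.comp measurable_swap
  rw [integrable_prod_iff hm.aestronglyMeasurable]
  constructor
  · refine Filter.Eventually.of_forall fun θ => ?_
    exact (((intervalIntegrable_iff_integrableOn_Ioc_of_le hab).1
      (intervalIntegrable_inv_speed θ a b))).const_mul (h θ)
  · have : (fun θ => ∫ y in Set.Ioc a b, ‖Function.uncurry (fun θ y => h θ * (2 / speed y θ)) (θ, y)‖)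
        = fun θ => |h θ| * (2 * speed b θ - 2 * speed a θ) := by
      funext θ
      rw [← integral_inv_speed, intervalIntegral.integral_of_le hab, ← integral_const_mul]
      refine integral_congr_ae (Filter.Eventually.of_forall fun y => ?_)
      simp only [Function.uncurry, norm_mul, Real.norm_eq_abs]
      rw [abs_of_nonneg (div_nonneg zero_le_two (speed_nonneg y θ))]
    rw [this]
    have hc : Continuous fun θ => |h θ| * (2 * speed b θ - 2 * speed a θ) := by
      unfold speed; fun_prop
    exact (intervalIntegrable_iff_integrableOn_Ioc_of_le (by positivity)).1
      (hc.intervalIntegrable 0 (2 * Real.pi))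

lemma intervalIntegrable_weightedPeriod {h : ℝ → ℝ} (hh : Continuous h) (a b : ℝ) :
    IntervalIntegrable (weightedPeriod h) volume a b := by
  have key : ∀ a b, a ≤ b → IntervalIntegrable (weightedPeriod h) volume a b := by
    intro a b hab
    rw [intervalIntegrable_iff_integrableOn_Ioc_of_le hab]
    have := (integrable_prod_period hh hab).integral_prod_right
    refine this.congr (Filter.Eventually.of_forall fun y => ?_)
    simp only [Function.uncurry, weightedPeriod]
    rw [intervalIntegral.integral_of_le (by positivity)]
  rcases le_total a b with hab | hab
  exacts [key a b hab, (key b a hab).symm]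

lemma integral_weightedPeriod {h : ℝ → ℝ} (hh : Continuous h) (a b : ℝ) :
    ∫ y in a..b, weightedPeriod h y = weightedArea h b - weightedArea h a := by
  have key : ∀ a b, a ≤ b →
      ∫ y in a..b, weightedPeriod h y = weightedArea h b - weightedArea h a := by
    intro a b hab
    have hpi : (0 : ℝ) ≤ 2 * Real.pi := by positivity
    have hs := integral_integral_swap (integrable_prod_period hh hab)
    have h1 : ∫ y in a..b, weightedPeriod h y = ∫ y in Set.Ioc a b,
        ∫ θ in Set.Ioc 0 (2 * Real.pi), h θ * (2 / speed y θ) := by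
      rw [intervalIntegral.integral_of_le hab]
      refine integral_congr_ae (Filter.Eventually.of_forall fun y => ?_)
      simp only [weightedPeriod]
      rw [intervalIntegral.integral_of_le hpi]
    rw [h1, ← hs, ← intervalIntegral.integral_of_le hpi]
    unfold weightedArea
    have hc : ∀ c, Continuous fun θ => h θ * (2 * speed c θ) := by
      intro c; unfold speed; fun_prop
    rw [← intervalIntegral.integral_sub ((hc b).intervalIntegrable _ _)
      ((hc a).intervalIntegrable _ _)]
    refine intervalIntegral.integral_congr fun θ _ => ?_
    rw [integral_const_mul, ← intervalIntegral.integral_of_le hab, integral_inv_speed]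
    ring
  rcases le_total a b with hab | hab
  · exact key a b hab
  · rw [intervalIntegral.integral_symm, key b a hab]; ring


/-! ### The half-angle substitution below the separatrix -/

/-- The half-angle substitution `sin (θ / 2) = k sin ψ` that parametrizes a bounded orbit of the
pendulum of energy `2 k² - 1`. -/
noncomputable def orbitAngle (k ψ : ℝ) : ℝ := 2 * Real.arcsin (k * Real.sin ψ)

section Substitution

variable {k : ℝ}

lemma mul_sin_sq_lt_one (hk0 : 0 < k) (hk1 : k < 1) (ψ : ℝ) : (k * Real.sin ψ) ^ 2 < 1 := by
  have := Real.sin_sq_le_one ψ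
  rw [mul_pow]
  nlinarith [sq_nonneg (Real.sin ψ)]

lemma cos_orbitAngle (hk0 : 0 < k) (hk1 : k < 1) (ψ : ℝ) :
    Real.cos (orbitAngle k ψ) = 1 - 2 * (k * Real.sin ψ) ^ 2 := by
  have h := abs_lt.1 ((sq_lt_one_iff_abs_lt_one _).1 (mul_sin_sq_lt_one hk0 hk1 ψ))
  rw [orbitAngle, Real.cos_two_mul, Real.cos_sq', Real.sin_arcsin h.1.le h.2.le]
  ring

lemma hasDerivAt_orbitAngle (hk0 : 0 < k) (hk1 : k < 1) (ψ : ℝ) :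
    HasDerivAt (orbitAngle k)
      (2 * (1 / √(1 - (k * Real.sin ψ) ^ 2) * (k * Real.cos ψ))) ψ := by
  have h := abs_lt.1 ((sq_lt_one_iff_abs_lt_one _).1 (mul_sin_sq_lt_one hk0 hk1 ψ))
  exact ((Real.hasDerivAt_arcsin h.1.ne' h.2.ne).comp ψ
    ((Real.hasDerivAt_sin ψ).const_mul k)).const_mul 2

lemma injOn_orbitAngle (hk0 : 0 < k) (hk1 : k < 1) :
    Set.InjOn (orbitAngle k) (Set.Ioo (-(Real.pi / 2)) (Real.pi / 2)) := by
  intro x hx y hy hxy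
  have h1 := abs_lt.1 ((sq_lt_one_iff_abs_lt_one _).1 (mul_sin_sq_lt_one hk0 hk1 x))
  have h2 := abs_lt.1 ((sq_lt_one_iff_abs_lt_one _).1 (mul_sin_sq_lt_one hk0 hk1 y))
  have h3 : Real.arcsin (k * Real.sin x) = Real.arcsin (k * Real.sin y) := by
    unfold orbitAngle at hxy; linarith
  have h4 := Real.injOn_arcsin ⟨h1.1.le, h1.2.le⟩ ⟨h2.1.le, h2.2.le⟩ h3
  exact Real.injOn_sin (Set.Ioo_subset_Icc_self hx) (Set.Ioo_subset_Icc_self hy)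
    (mul_left_cancel₀ hk0.ne' h4)

lemma image_orbitAngle (hk0 : 0 < k) (hk1 : k < 1) :
    orbitAngle k '' Set.Ioo (-(Real.pi / 2)) (Real.pi / 2) =
      Set.Ioc (-Real.pi) Real.pi ∩ {θ | 0 < 2 * k ^ 2 - 1 + Real.cos θ} := by
  ext θ
  constructor
  · rintro ⟨ψ, hψ, rfl⟩
    have h := abs_lt.1 ((sq_lt_one_iff_abs_lt_one _).1 (mul_sin_sq_lt_one hk0 hk1 ψ))
    refine ⟨⟨?_, ?_⟩, ?_⟩
    · have := (Real.neg_pi_div_two_lt_arcsin).2 h.1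
      unfold orbitAngle; linarith
    · have := (Real.arcsin_le_pi_div_two) (k * Real.sin ψ)
      unfold orbitAngle; linarith
    · have hc := Real.cos_pos_of_mem_Ioo hψ
      simp only [Set.mem_ofPred_eq, cos_orbitAngle hk0 hk1, mul_pow, Real.sin_sq]
      have : 0 < k ^ 2 * Real.cos ψ ^ 2 := by positivity
      linarith
  · rintro ⟨hθ, hpos⟩
    have hpos' : Real.sin (θ / 2) ^ 2 < k ^ 2 := by
      have : Real.cos θ = 1 - 2 * Real.sin (θ / 2) ^ 2 := by
        have h := Real.cos_two_mul (θ / 2)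
        rw [Real.cos_sq'] at h
        rw [show θ = 2 * (θ / 2) by ring, h]; ring_nf
      rw [Set.mem_ofPred_eq, this] at hpos
      linarith
    have habs := abs_lt.1 (abs_lt_of_sq_lt_sq hpos' hk0.le)
    have h1 : -1 < Real.sin (θ / 2) / k := by rw [lt_div_iff₀ hk0]; linarith
    have h2 : Real.sin (θ / 2) / k < 1 := by rw [div_lt_iff₀ hk0]; linarith
    refine ⟨Real.arcsin (Real.sin (θ / 2) / k), ⟨(Real.neg_pi_div_two_lt_arcsin).2 h1,
      (Real.arcsin_lt_pi_div_two).2 h2⟩, ?_⟩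
    unfold orbitAngle
    rw [Real.sin_arcsin h1.le h2.le, mul_div_cancel₀ _ hk0.ne',
      Real.arcsin_sin (by linarith [hθ.1]) (by linarith [hθ.2])]
    ring

/-- The speed becomes `2 k cos ψ`, which cancels the `k cos ψ` of the Jacobian. The turning-point
singularity disappears and a complete elliptic integrand remains. -/
lemma orbitAngle_integrand (hk0 : 0 < k) (hk1 : k < 1) (g : ℝ → ℝ) {ψ : ℝ}
    (hψ : ψ ∈ Set.Ioo (-(Real.pi / 2)) (Real.pi / 2)) :
    |2 * (1 / √(1 - (k * Real.sin ψ) ^ 2) * (k * Real.cos ψ))| •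
        (g (Real.cos (orbitAngle k ψ)) * (2 / speed (2 * k ^ 2 - 1) (orbitAngle k ψ))) =
      g (1 - 2 * (k * Real.sin ψ) ^ 2) * (2 / √(1 - (k * Real.sin ψ) ^ 2)) := by
  have hc := Real.cos_pos_of_mem_Ioo hψ
  have hs : 0 < √(1 - (k * Real.sin ψ) ^ 2) :=
    Real.sqrt_pos.2 (by linarith [mul_sin_sq_lt_one hk0 hk1 ψ])
  have hsp : speed (2 * k ^ 2 - 1) (orbitAngle k ψ) = 2 * (k * Real.cos ψ) := by
    rw [speed, cos_orbitAngle hk0 hk1,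
      show 2 * (2 * k ^ 2 - 1 + (1 - 2 * (k * Real.sin ψ) ^ 2)) = (2 * (k * Real.cos ψ)) ^ 2 by
        rw [mul_pow, mul_pow, mul_pow, Real.sin_sq]; ring]
    exact Real.sqrt_sq (by positivity)
  rw [abs_of_pos (by positivity), hsp, cos_orbitAngle hk0 hk1, smul_eq_mul]
  field_simp

lemma continuous_orbit_integrand {g : ℝ → ℝ} (hg : Continuous g) (hk0 : 0 < k) (hk1 : k < 1) :
    Continuous fun ψ => g (1 - 2 * (k * Real.sin ψ) ^ 2) * (2 / √(1 - (k * Real.sin ψ) ^ 2)) := by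
  refine (hg.comp (by fun_prop)).mul (continuous_const.div (by fun_prop) fun ψ => ?_)
  exact (Real.sqrt_pos.2 (by linarith [mul_sin_sq_lt_one hk0 hk1 ψ])).ne'

/-- The convention `2 / 0 = 0` makes an integral over the whole circle an integral over the
accessible well. -/
lemma indicator_period (g : ℝ → ℝ) (x : ℝ) :
    (fun θ => g (Real.cos θ) * (2 / speed x θ)) =
      Set.indicator {θ | 0 < x + Real.cos θ} fun θ => g (Real.cos θ) * (2 / speed x θ) := by
  funext θ
  by_cases h : 0 < x + Real.cos θ
  · rw [Set.indicator_of_mem (by exact h)]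
  · rw [Set.indicator_of_notMem (by exact h), speed_eq_zero (not_lt.1 h)]; simp

lemma measurableSet_accessible (x : ℝ) : MeasurableSet {θ | 0 < x + Real.cos θ} :=
  measurableSet_lt measurable_const (by fun_prop)

lemma periodic_period (g : ℝ → ℝ) (x : ℝ) :
    Function.Periodic (fun θ => g (Real.cos θ) * (2 / speed x θ)) (2 * Real.pi) := by
  intro θ; simp [speed, Real.cos_add_two_pi]

lemma intervalIntegrable_period_of_lt_one {g : ℝ → ℝ} (hg : Continuous g)
    (hk0 : 0 < k) (hk1 : k < 1) (a b : ℝ) :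
    IntervalIntegrable (fun θ => g (Real.cos θ) * (2 / speed (2 * k ^ 2 - 1) θ)) volume a b := by
  refine (periodic_period g _).intervalIntegrable (t := -Real.pi) (by positivity) ?_ a b
  rw [show -Real.pi + 2 * Real.pi = Real.pi by ring,
    intervalIntegrable_iff_integrableOn_Ioc_of_le (by linarith [Real.pi_pos]), indicator_period,
    IntegrableOn, integrable_indicator_iff (measurableSet_accessible _),
    IntegrableOn, Measure.restrict_restrict (measurableSet_accessible _), Set.inter_comm,
    ← image_orbitAngle hk0 hk1]
  refine (integrableOn_image_iff_integrableOn_abs_deriv_smul measurableSet_Ioo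
    (fun ψ _ => (hasDerivAt_orbitAngle hk0 hk1 ψ).hasDerivWithinAt)
    (injOn_orbitAngle hk0 hk1) _).2 ?_
  refine IntegrableOn.congr_fun (f := fun ψ =>
    g (1 - 2 * (k * Real.sin ψ) ^ 2) * (2 / √(1 - (k * Real.sin ψ) ^ 2))) ?_
    (fun ψ hψ => (orbitAngle_integrand hk0 hk1 g hψ).symm) measurableSet_Ioo
  exact ((continuous_orbit_integrand hg hk0 hk1).integrableOn_Icc).mono_set Set.Ioo_subset_Icc_self

lemma weightedPeriod_eq_of_lt_one (hk0 : 0 < k) (hk1 : k < 1) (g : ℝ → ℝ) :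
    weightedPeriod (fun θ => g (Real.cos θ)) (2 * k ^ 2 - 1) =
      ∫ ψ in (-(Real.pi / 2))..(Real.pi / 2),
        g (1 - 2 * (k * Real.sin ψ) ^ 2) * (2 / √(1 - (k * Real.sin ψ) ^ 2)) := by
  have h := (periodic_period g (2 * k ^ 2 - 1)).intervalIntegral_add_eq 0 (-Real.pi)
  rw [zero_add, show -Real.pi + 2 * Real.pi = Real.pi by ring] at h
  rw [weightedPeriod, h, intervalIntegral.integral_of_le (by linarith [Real.pi_pos]),
    indicator_period, setIntegral_indicator (measurableSet_accessible _),
    ← image_orbitAngle hk0 hk1,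
    integral_image_eq_integral_abs_deriv_smul measurableSet_Ioo
    (fun ψ _ => (hasDerivAt_orbitAngle hk0 hk1 ψ).hasDerivWithinAt)
    (injOn_orbitAngle hk0 hk1),
    intervalIntegral.integral_of_le (by linarith [Real.pi_pos]), integral_Ioc_eq_integral_Ioo]
  exact setIntegral_congr_fun measurableSet_Ioo fun ψ hψ => orbitAngle_integrand hk0 hk1 g hψ

end Substitution

/-! ### Regularity in the energy away from the separatrix -/

lemma exists_modulus {x : ℝ} (h0 : -1 < x) (h1 : x < 1) :
    0 < √((1 + x) / 2) ∧ √((1 + x) / 2) < 1 ∧ 2 * √((1 + x) / 2) ^ 2 - 1 = x := by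
  refine ⟨Real.sqrt_pos.2 (by linarith), ?_, ?_⟩
  · rw [Real.sqrt_lt' one_pos]; linarith
  · rw [Real.sq_sqrt (by linarith)]; ring

lemma continuous_inv_speed_of_one_lt {x : ℝ} (hx : 1 < x) :
    Continuous fun θ => 2 / speed x θ := by
  refine continuous_const.div (by unfold speed; fun_prop) fun θ => (speed_pos ?_).ne'
  linarith [Real.neg_one_le_cos θ]

lemma intervalIntegrable_period {g : ℝ → ℝ} (hg : Continuous g) {x : ℝ} (h0 : -1 < x)
    (h1 : x ≠ 1) (a b : ℝ) :
    IntervalIntegrable (fun θ => g (Real.cos θ) * (2 / speed x θ)) volume a b := by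
  rcases lt_or_gt_of_ne h1 with h1 | h1
  · obtain ⟨hk0, hk1, hk⟩ := exists_modulus h0 h1
    rw [← hk]
    exact intervalIntegrable_period_of_lt_one hg hk0 hk1 a b
  · exact ((hg.comp Real.continuous_cos).mul
      (continuous_inv_speed_of_one_lt h1)).intervalIntegrable a b

/-- For `x < 1` the well moves with `x`, but after the substitution the domain is fixed and the
integrand is locally bounded. For `x > 1` the speed is bounded away from zero and dominated
convergence applies directly. -/
lemma continuousAt_weightedPeriod {g : ℝ → ℝ} (hg : Continuous g) {x : ℝ} (h0 : -1 < x)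
    (h1 : x ≠ 1) : ContinuousAt (weightedPeriod fun θ => g (Real.cos θ)) x := by
  obtain ⟨C, hC⟩ : ∃ C, ∀ y ∈ Set.Icc (-1 : ℝ) 1, ‖g y‖ ≤ C :=
    isCompact_Icc.exists_bound_of_continuousOn hg.continuousOn
  have hC0 : 0 ≤ C := (norm_nonneg _).trans (hC 0 (by norm_num))
  rcases lt_or_gt_of_ne h1 with h1 | h1
  · have hcont : ContinuousAt (fun y => ∫ ψ in (-(Real.pi / 2))..(Real.pi / 2),
        g (1 - 2 * (√((1 + y) / 2) * Real.sin ψ) ^ 2) *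
          (2 / √(1 - (√((1 + y) / 2) * Real.sin ψ) ^ 2))) x := by
      obtain ⟨c, hc1, hc2⟩ := exists_between h1
      have hnear : ∀ᶠ y in nhds x, y ∈ Set.Ioo (-1) c := Ioo_mem_nhds h0 hc1
      refine intervalIntegral.continuousAt_of_dominated_interval
        (bound := fun _ => C * (2 / √((1 - c) / 2))) ?_ ?_ (intervalIntegrable_const) ?_
      · filter_upwards [hnear] with y hy
        obtain ⟨hk0, hk1, _⟩ := exists_modulus hy.1 (hy.2.trans hc2)
        exact (continuous_orbit_integrand hg hk0 hk1).aestronglyMeasurable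
      · filter_upwards [hnear] with y hy
        obtain ⟨hk0, hk1, hk⟩ := exists_modulus hy.1 (hy.2.trans hc2)
        refine Filter.Eventually.of_forall fun ψ _ => ?_
        have h3 := mul_sin_sq_lt_one hk0 hk1 ψ
        -- Here `c < 1` bounds the nearby energies, so `1 - k² sin² ψ ≥ (1 - c) / 2`, the quantity
        -- in the dominating constant.
        have h4 : (√((1 + y) / 2) * Real.sin ψ) ^ 2 ≤ (1 + c) / 2 := by
          rw [mul_pow, Real.sq_sqrt (by linarith [hy.1])]
          have := Real.sin_sq_le_one ψ
          nlinarith [hy.1, hy.2]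
        rw [norm_mul, Real.norm_of_nonneg (by positivity : 0 ≤ 2 / √_)]
        refine mul_le_mul (hC _ ⟨by linarith, by linarith [sq_nonneg (√((1 + y) / 2) * Real.sin ψ)]⟩)
          (div_le_div_of_nonneg_left zero_le_two (Real.sqrt_pos.2 (by linarith))
            (Real.sqrt_le_sqrt (by linarith))) (by positivity) hC0
      · refine Filter.Eventually.of_forall fun ψ _ => ?_
        obtain ⟨hk0, hk1, _⟩ := exists_modulus h0 h1
        have hne : √(1 - (√((1 + x) / 2) * Real.sin ψ) ^ 2) ≠ 0 :=
          (Real.sqrt_pos.2 (by linarith [mul_sin_sq_lt_one hk0 hk1 ψ])).ne'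
        refine ContinuousAt.mul (hg.comp (by fun_prop)).continuousAt
          (continuousAt_const.div (by fun_prop) hne)
    refine hcont.congr ?_
    filter_upwards [Ioo_mem_nhds h0 h1] with y hy
    obtain ⟨hk0, hk1, hk⟩ := exists_modulus hy.1 hy.2
    rw [← weightedPeriod_eq_of_lt_one hk0 hk1, hk]
  · obtain ⟨c, hc1, hc2⟩ := exists_between h1
    have hnear : ∀ᶠ y in nhds x, c < y := lt_mem_nhds hc2
    refine intervalIntegral.continuousAt_of_dominated_interval
        (bound := fun _ => C * (2 / √(2 * (c - 1)))) ?_ ?_ (intervalIntegrable_const) ?_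
    · filter_upwards [hnear] with y hy
      exact ((hg.comp Real.continuous_cos).mul
        (continuous_inv_speed_of_one_lt (hc1.trans hy))).aestronglyMeasurable
    · filter_upwards [hnear] with y hy
      refine Filter.Eventually.of_forall fun θ _ => ?_
      rw [norm_mul, Real.norm_of_nonneg (div_nonneg zero_le_two (speed_nonneg _ _))]
      refine mul_le_mul (hC _ ⟨Real.neg_one_le_cos θ, Real.cos_le_one θ⟩)
        (div_le_div_of_nonneg_left zero_le_two (Real.sqrt_pos.2 (by linarith))
          (Real.sqrt_le_sqrt (by linarith [Real.neg_one_le_cos θ])))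
        (div_nonneg zero_le_two (speed_nonneg _ _)) hC0
    · refine Filter.Eventually.of_forall fun θ _ => ?_
      have hne : speed x θ ≠ 0 := (speed_pos (by linarith [Real.neg_one_le_cos θ])).ne'
      refine continuousAt_const.mul (continuousAt_const.div ?_ hne)
      unfold speed; fun_prop

lemma hasDerivAt_weightedArea {g : ℝ → ℝ} (hg : Continuous g) {x : ℝ} (h0 : -1 < x)
    (h1 : x ≠ 1) :
    HasDerivAt (weightedArea fun θ => g (Real.cos θ))
      (weightedPeriod (fun θ => g (Real.cos θ)) x) x := by
  have hh : Continuous fun θ => g (Real.cos θ) := hg.comp Real.continuous_cos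
  have h := intervalIntegral.integral_hasDerivAt_right
    (intervalIntegrable_weightedPeriod hh 0 x)
    (ContinuousAt.stronglyMeasurableAtFilter (isOpen_Ioi.inter isOpen_compl_singleton)
      (fun y hy => continuousAt_weightedPeriod hg hy.1 hy.2) x ⟨h0, h1⟩)
    (continuousAt_weightedPeriod hg h0 h1)
  refine (h.add_const (weightedArea (fun θ => g (Real.cos θ)) 0)).congr_of_eventuallyEq
    (Filter.Eventually.of_forall fun y => ?_)
  simp only [integral_weightedPeriod hh]
  ring


/-! ### Areas, periods and the variance of the cosine -/

/-- The area of `{v² / 2 - cos θ < x}`. -/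
noncomputable def area : ℝ → ℝ := weightedArea fun _ => 1

/-- The integral of `cos θ` over `{v² / 2 - cos θ < x}`. -/
noncomputable def cosArea : ℝ → ℝ := weightedArea fun θ => Real.cos θ

noncomputable def period : ℝ → ℝ := weightedPeriod fun _ => 1

noncomputable def cosPeriod : ℝ → ℝ := weightedPeriod fun θ => Real.cos θ

noncomputable def cosSqPeriod : ℝ → ℝ := weightedPeriod fun θ => Real.cos θ ^ 2

/-- The unnormalized variance of `cos` on the level set of energy `x`. -/
noncomputable def cosVariance (x : ℝ) : ℝ := cosSqPeriod x - cosPeriod x ^ 2 / period x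

lemma continuous_area : Continuous area := continuous_weightedArea continuous_const

lemma continuous_cosArea : Continuous cosArea := continuous_weightedArea Real.continuous_cos

lemma hasDerivAt_area {x : ℝ} (h0 : -1 < x) (h1 : x ≠ 1) : HasDerivAt area (period x) x :=
  hasDerivAt_weightedArea (g := fun _ => 1) continuous_const h0 h1

lemma hasDerivAt_cosArea {x : ℝ} (h0 : -1 < x) (h1 : x ≠ 1) :
    HasDerivAt cosArea (cosPeriod x) x :=
  hasDerivAt_weightedArea (g := fun c => c) continuous_id h0 h1

lemma continuous_speed_right (x : ℝ) : Continuous (speed x) := by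
  unfold speed; fun_prop

lemma area_eq_zero {x : ℝ} (h : x ≤ -1) : area x = 0 := by
  unfold area weightedArea
  rw [intervalIntegral.integral_congr (g := fun _ => 0)]
  · simp
  · intro θ _
    simp only
    rw [speed_eq_zero (by linarith [Real.cos_le_one θ])]; simp

lemma area_lt_area {x y : ℝ} (hx : -1 ≤ x) (hxy : x < y) : area x < area y := by
  unfold area weightedArea
  have := continuous_speed_right
  refine intervalIntegral.integral_lt_integral_of_continuousOn_of_le_of_exists_lt
    (by positivity) (by fun_prop) (by fun_prop) (fun θ _ => ?_)
    ⟨0, ⟨le_rfl, by positivity⟩, ?_⟩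
  · linarith [speed_mono hxy.le θ]
  · have : speed x 0 < speed y 0 := by
      refine Real.sqrt_lt_sqrt ?_ ?_ <;> rw [Real.cos_zero] <;> linarith
    linarith

lemma area_mono : Monotone area := by
  intro x y hxy
  rcases le_total x (-1) with hx | hx
  · rw [area_eq_zero hx]
    exact intervalIntegral.integral_nonneg (by positivity) fun θ _ => by
      have := speed_nonneg y θ
      positivity
  · rcases hxy.eq_or_lt with rfl | h
    exacts [le_rfl, (area_lt_area hx h).le]

lemma area_pos {x : ℝ} (hx : -1 < x) : 0 < area x := by
  simpa [area_eq_zero le_rfl] using area_lt_area le_rfl hx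

lemma area_nonneg (x : ℝ) : 0 ≤ area x :=
  (area_eq_zero (min_le_right x (-1))).symm.le.trans (area_mono (min_le_left _ _))

lemma abs_cosArea_le (x : ℝ) : |cosArea x| ≤ area x := by
  have := continuous_speed_right x
  refine (intervalIntegral.abs_integral_le_integral_abs (by positivity)).trans
    (intervalIntegral.integral_mono_on (by positivity)
      (Continuous.intervalIntegrable (by fun_prop) _ _)
      (Continuous.intervalIntegrable (by fun_prop) _ _) fun θ _ => ?_)
  have h2 := speed_nonneg x θ
  rw [abs_mul, abs_of_nonneg (by positivity : 0 ≤ 2 * speed x θ)]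
  exact mul_le_mul_of_nonneg_right (Real.abs_cos_le_one θ) (by positivity)

/-- This is `speed² = 2 (x + cos θ)` divided by the speed, also valid outside the well. It expresses
areas linearly through period integrals. -/
lemma two_mul_speed_eq (x θ : ℝ) :
    2 * speed x θ = 2 * ((x + Real.cos θ) * (2 / speed x θ)) := by
  rcases le_or_gt (x + Real.cos θ) 0 with h | h
  · simp [speed_eq_zero h]
  · have h1 := sq_speed h.le
    have h2 := speed_pos h
    field_simp
    linarith

section Identities

variable {x : ℝ} (h0 : -1 < x) (h1 : x ≠ 1)
include h0 h1

lemma intervalIntegrable_one_period :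
    IntervalIntegrable (fun θ => 1 * (2 / speed x θ)) volume 0 (2 * Real.pi) :=
  intervalIntegrable_period (g := fun _ => 1) continuous_const h0 h1 _ _

lemma intervalIntegrable_cos_period :
    IntervalIntegrable (fun θ => Real.cos θ * (2 / speed x θ)) volume 0 (2 * Real.pi) :=
  intervalIntegrable_period (g := fun c => c) continuous_id h0 h1 _ _

lemma intervalIntegrable_cos_sq_period :
    IntervalIntegrable (fun θ => Real.cos θ ^ 2 * (2 / speed x θ)) volume 0 (2 * Real.pi) :=
  intervalIntegrable_period (g := fun c => c ^ 2) (by fun_prop) h0 h1 _ _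

lemma area_eq : area x = 2 * (x * period x + cosPeriod x) := by
  unfold area period cosPeriod weightedArea weightedPeriod
  rw [← intervalIntegral.integral_const_mul, ← intervalIntegral.integral_add
    ((intervalIntegrable_one_period h0 h1).const_mul x) (intervalIntegrable_cos_period h0 h1),
    ← intervalIntegral.integral_const_mul]
  refine intervalIntegral.integral_congr fun θ _ => ?_
  simp only
  rw [two_mul_speed_eq]; ring

lemma cosArea_eq : cosArea x = 2 * (x * cosPeriod x + cosSqPeriod x) := by
  unfold cosArea cosPeriod cosSqPeriod weightedArea weightedPeriod
  rw [← intervalIntegral.integral_const_mul, ← intervalIntegral.integral_add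
    ((intervalIntegrable_cos_period h0 h1).const_mul x) (intervalIntegrable_cos_sq_period h0 h1),
    ← intervalIntegral.integral_const_mul]
  refine intervalIntegral.integral_congr fun θ _ => ?_
  simp only
  rw [two_mul_speed_eq]; ring

lemma integral_cos_sub_sq (c : ℝ) :
    ∫ θ in (0 : ℝ)..(2 * Real.pi), (Real.cos θ - c) ^ 2 * (2 / speed x θ) =
      cosSqPeriod x - 2 * c * cosPeriod x + c ^ 2 * period x := by
  unfold period cosPeriod cosSqPeriod weightedPeriod
  rw [← intervalIntegral.integral_const_mul, ← intervalIntegral.integral_const_mul,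
    ← intervalIntegral.integral_sub (intervalIntegrable_cos_sq_period h0 h1)
      ((intervalIntegrable_cos_period h0 h1).const_mul _),
    ← intervalIntegral.integral_add ((intervalIntegrable_cos_sq_period h0 h1).sub
      ((intervalIntegrable_cos_period h0 h1).const_mul _))
      ((intervalIntegrable_one_period h0 h1).const_mul _)]
  refine intervalIntegral.integral_congr fun θ _ => ?_
  ring

lemma period_pos : 0 < period x := by
  have hx : 0 < x + 1 := by linarith
  have h : area x ≤ 2 * (x + 1) * period x := by
    unfold area period weightedArea weightedPeriod
    rw [← intervalIntegral.integral_const_mul]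
    have := continuous_speed_right x
    refine intervalIntegral.integral_mono_on (by positivity)
      (Continuous.intervalIntegrable (by fun_prop) _ _)
      ((intervalIntegrable_one_period h0 h1).const_mul _) fun θ _ => ?_
    have h2 : 0 ≤ 2 / speed x θ := div_nonneg zero_le_two (speed_nonneg _ _)
    rw [two_mul_speed_eq]
    nlinarith [Real.cos_le_one θ]
  exact pos_of_mul_pos_right ((area_pos h0).trans_le h) (by positivity)

lemma integral_cos_sub_mean_sq :
    ∫ θ in (0 : ℝ)..(2 * Real.pi), (Real.cos θ - cosPeriod x / period x) ^ 2 * (2 / speed x θ) =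
      cosVariance x := by
  have := (period_pos h0 h1).ne'
  rw [integral_cos_sub_sq h0 h1, cosVariance]
  field_simp
  ring

lemma cosVariance_nonneg : 0 ≤ cosVariance x := by
  rw [← integral_cos_sub_mean_sq h0 h1]
  exact intervalIntegral.integral_nonneg (by positivity) fun θ _ =>
    mul_nonneg (sq_nonneg _) (div_nonneg zero_le_two (speed_nonneg _ _))

/-- Writing both areas through periods, the terms carrying `x` cancel. The left side is what
differentiating `cosProfile` at fixed area produces. -/
lemma cosArea_sub : cosArea x - area x * (cosPeriod x / period x) = 2 * cosVariance x := by
  have := (period_pos h0 h1).ne'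
  rw [cosArea_eq h0 h1, area_eq h0 h1, cosVariance]
  field_simp
  ring

end Identities

/-! ### A bound on the variance uniform up to the separatrix -/

lemma one_sub_mul_sin_sq_pos {k : ℝ} (hk0 : 0 < k) (hk1 : k < 1) (ψ : ℝ) :
    0 < 1 - (k * Real.sin ψ) ^ 2 := by linarith [mul_sin_sq_lt_one hk0 hk1 ψ]

/-- The weight vanishes at `θ = π`, the hyperbolic point responsible for the divergence of the
period. Below the separatrix the substituted integrand is `8 y ^ (3 / 2) ≤ 8` with `y = 1 - k² sin²
ψ`, on length `π`. Above it, `1 + cos θ = speed 1 θ ^ 2 / 2` and `speed 1 θ ≤ speed x θ` bound the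
integrand by `4` on length `2π`. -/
lemma integral_one_add_cos_sq_le {x : ℝ} (h0 : -1 < x) (h1 : x ≠ 1) :
    ∫ θ in (0 : ℝ)..(2 * Real.pi), (1 + Real.cos θ) ^ 2 * (2 / speed x θ) ≤ 8 * Real.pi := by
  have hpi := Real.pi_pos
  rcases lt_or_gt_of_ne h1 with h1 | h1
  · obtain ⟨hk0, hk1, hk⟩ := exists_modulus h0 h1
    have h := weightedPeriod_eq_of_lt_one hk0 hk1 (fun c => (1 + c) ^ 2)
    rw [hk, weightedPeriod] at h
    rw [h]
    have hb := intervalIntegral.integral_mono_on (μ := volume) (by linarith : -(Real.pi / 2) ≤ Real.pi / 2)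
      ((continuous_orbit_integrand (g := fun c => (1 + c) ^ 2) (by fun_prop) hk0 hk1).intervalIntegrable _ _)
      (intervalIntegrable_const (c := (8 : ℝ))) (fun ψ _ => ?_)
    · refine hb.trans_eq ?_
      rw [intervalIntegral.integral_const, smul_eq_mul]; ring
    · set y := 1 - (√((1 + x) / 2) * Real.sin ψ) ^ 2 with hy
      have hy0 : 0 < y := one_sub_mul_sin_sq_pos hk0 hk1 ψ
      have hy1 : y ≤ 1 := by rw [hy]; linarith [sq_nonneg (√((1 + x) / 2) * Real.sin ψ)]
      have hs := Real.sqrt_pos.2 hy0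
      have hs1 : √y ≤ 1 := Real.sqrt_le_one.2 hy1
      have hsq := Real.sq_sqrt hy0.le
      have : 1 + (1 - 2 * (√((1 + x) / 2) * Real.sin ψ) ^ 2) = 2 * √y ^ 2 := by
        rw [hsq, hy]; ring
      rw [this, show (2 * √y ^ 2) ^ 2 * (2 / √y) = 8 * √y ^ 3 by field_simp; ring]
      linarith [pow_le_one₀ (n := 3) hs.le hs1]
  · have hb := intervalIntegral.integral_mono_on (μ := volume) (by positivity : 0 ≤ 2 * Real.pi)
      (intervalIntegrable_period (g := fun c => (1 + c) ^ 2) (by fun_prop) h0 h1.ne' _ _)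
      (intervalIntegrable_const (c := (4 : ℝ))) (fun θ _ => ?_)
    · refine hb.trans_eq ?_
      rw [intervalIntegral.integral_const, smul_eq_mul]; ring
    · have hc := Real.neg_one_le_cos θ
      have hc1 := Real.cos_le_one θ
      have hw : 0 < speed x θ := speed_pos (by linarith)
      have hr := sq_speed (x := 1) (θ := θ) (by linarith)
      have hr0 := speed_nonneg 1 θ
      have hrw := speed_mono h1.le θ
      have hr2 : speed 1 θ ≤ 2 := by
        refine abs_le_of_sq_le_sq' ?_ zero_le_two |>.2
        linarith
      rw [show 1 + Real.cos θ = speed 1 θ ^ 2 / 2 by rw [hr]; ring, ← mul_div_assoc,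
        div_le_iff₀ hw]
      have : speed 1 θ ^ 3 ≤ 8 := by
        calc speed 1 θ ^ 3 ≤ 2 ^ 3 := pow_le_pow_left₀ hr0 hr2 3
          _ = 8 := by norm_num
      nlinarith

/-- The variance is at most the second moment about any point; the point `-1` is the value of `cos`
at the hyperbolic point. -/
lemma cosVariance_le {x : ℝ} (h0 : -1 < x) (h1 : x ≠ 1) : cosVariance x ≤ 8 * Real.pi := by
  refine le_trans ?_ (integral_one_add_cos_sq_le h0 h1)
  have h := integral_cos_sub_sq h0 h1 (-1)
  simp only [sub_neg_eq_add, add_comm _ (1 : ℝ)] at h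
  have hp := period_pos h0 h1
  rw [h, cosVariance]
  have : 0 ≤ (cosPeriod x + period x) ^ 2 / period x := by positivity
  have e : (cosPeriod x + period x) ^ 2 / period x
      = cosPeriod x ^ 2 / period x + 2 * cosPeriod x + period x := by
    field_simp
    ring
  linarith

/-! ### Inverting the area -/

/-- A strictly increasing bijection of `ℝ` that agrees with `area` on `[-1, ∞)`. -/
noncomputable def areaExt (x : ℝ) : ℝ := area x + min (x + 1) 0

lemma areaExt_of_le {x : ℝ} (h : -1 ≤ x) : areaExt x = area x := by
  rw [areaExt, min_eq_right (by linarith), add_zero]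

lemma areaExt_of_ge {x : ℝ} (h : x ≤ -1) : areaExt x = x + 1 := by
  rw [areaExt, min_eq_left (by linarith), area_eq_zero h, zero_add]

lemma strictMono_areaExt : StrictMono areaExt := by
  intro x y hxy
  rcases le_or_gt (-1) x with hx | hx
  · rw [areaExt_of_le hx, areaExt_of_le (hx.trans hxy.le)]
    exact area_lt_area hx hxy
  · refine add_lt_add_of_le_of_lt (area_mono hxy.le) ?_
    rw [min_eq_left (by linarith)]
    exact lt_min (by linarith) (by linarith)

lemma continuous_areaExt : Continuous areaExt :=
  continuous_area.add (by fun_prop)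

lemma sqrt_le_area (x : ℝ) : √(2 * (x - 1)) ≤ area x := by
  have h : ∫ θ in (0 : ℝ)..(2 * Real.pi), √(2 * (x - 1)) ≤ area x := by
    unfold area weightedArea
    have := continuous_speed_right x
    refine intervalIntegral.integral_mono_on (by positivity) intervalIntegrable_const
      (Continuous.intervalIntegrable (by fun_prop) _ _) fun θ _ => ?_
    have : √(2 * (x - 1)) ≤ speed x θ :=
      Real.sqrt_le_sqrt (by linarith [Real.neg_one_le_cos θ])
    linarith [speed_nonneg x θ]
  rw [intervalIntegral.integral_const, smul_eq_mul] at h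
  nlinarith [Real.sqrt_nonneg (2 * (x - 1)), Real.pi_gt_three]

lemma tendsto_area : Filter.Tendsto area Filter.atTop Filter.atTop := by
  refine Filter.tendsto_atTop_mono' _ (Filter.eventually_atTop.2 ⟨1, fun x _ => sqrt_le_area x⟩) ?_
  refine Real.tendsto_sqrt_atTop.comp (Filter.Tendsto.const_mul_atTop two_pos ?_)
  exact Filter.tendsto_atTop_add_const_right _ _ Filter.tendsto_id

lemma surjective_areaExt : Function.Surjective areaExt := by
  refine continuous_areaExt.surjective ?_ ?_
  · refine tendsto_area.congr' ?_
    filter_upwards [Filter.eventually_ge_atTop (-1)] with x hx using (areaExt_of_le hx).symm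
  · refine (Filter.tendsto_atBot_add_const_right _ (1 : ℝ) Filter.tendsto_id).congr' ?_
    filter_upwards [Filter.eventually_le_atBot (-1)] with x hx using (areaExt_of_ge hx).symm

/-- The inverse of an order isomorphism of `ℝ` is continuous, including across the separatrix where
differentiability is not established. -/
noncomputable def areaIso : ℝ ≃o ℝ :=
  StrictMono.orderIsoOfSurjective areaExt strictMono_areaExt surjective_areaExt

/-- The inverse of `area`: the energy whose sublevel set has area `u`. -/
noncomputable def energyOfArea (u : ℝ) : ℝ := areaIso.symm u

lemma continuous_energyOfArea : Continuous energyOfArea := areaIso.symm.continuous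

lemma areaExt_energyOfArea (u : ℝ) : areaExt (energyOfArea u) = u :=
  areaIso.apply_symm_apply u

lemma energyOfArea_areaExt (x : ℝ) : energyOfArea (areaExt x) = x :=
  areaIso.symm_apply_apply x

lemma energyOfArea_area {x : ℝ} (hx : -1 ≤ x) : energyOfArea (area x) = x := by
  rw [← areaExt_of_le hx, energyOfArea_areaExt]

lemma neg_one_lt_energyOfArea {u : ℝ} (hu : 0 < u) : -1 < energyOfArea u := by
  rw [← strictMono_areaExt.lt_iff_lt, areaExt_energyOfArea, areaExt_of_le le_rfl,
    area_eq_zero le_rfl]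
  exact hu

lemma area_energyOfArea {u : ℝ} (hu : 0 ≤ u) : area (energyOfArea u) = u := by
  rcases hu.eq_or_lt with rfl | hu
  · rw [← area_eq_zero (le_refl (-1)), energyOfArea_area le_rfl]
  · rw [← areaExt_of_le (neg_one_lt_energyOfArea hu).le, areaExt_energyOfArea]

/-- Positivity of `u` is essential: for `u = 0` the left side never holds, while the right side
holds for every `x < -1`. -/
lemma area_lt_iff {x u : ℝ} (hu : 0 < u) : area x < u ↔ x < energyOfArea u := by
  constructor
  · intro h
    by_contra! h'
    linarith [area_mono h', area_energyOfArea hu.le]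
  · intro h
    rcases le_total (-1) x with hx | hx
    · exact (area_lt_area hx h).trans_eq (area_energyOfArea hu.le)
    · rwa [area_eq_zero hx]

lemma energyOfArea_ne_one {u : ℝ} (hu : 0 ≤ u) (h : u ≠ area 1) : energyOfArea u ≠ 1 :=
  fun h' => h (by rw [← h', area_energyOfArea hu])

/-- The integral of `cos θ` over the sublevel set of area `u`. -/
noncomputable def cosIntegral (u : ℝ) : ℝ := cosArea (energyOfArea u)

/-- The integral of the energy over the sublevel set of area `u`. -/
noncomputable def energyIntegral (u : ℝ) : ℝ := ∫ σ in (0 : ℝ)..u, energyOfArea σ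

lemma continuous_cosIntegral : Continuous cosIntegral :=
  continuous_cosArea.comp continuous_energyOfArea

lemma abs_cosIntegral_le {u : ℝ} (hu : 0 ≤ u) : |cosIntegral u| ≤ u :=
  (abs_cosArea_le _).trans_eq (area_energyOfArea hu)

lemma hasDerivAt_energyOfArea {u : ℝ} (hu : 0 < u) (h : u ≠ area 1) :
    HasDerivAt energyOfArea (period (energyOfArea u))⁻¹ u := by
  have h0 := neg_one_lt_energyOfArea hu
  have h1 := energyOfArea_ne_one hu.le h
  refine HasDerivAt.of_local_left_inverse continuous_energyOfArea.continuousAt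
    (hasDerivAt_area h0 h1) (period_pos h0 h1).ne' ?_
  filter_upwards [lt_mem_nhds hu] with v hv using area_energyOfArea hv.le

lemma hasDerivAt_cosIntegral {u : ℝ} (hu : 0 < u) (h : u ≠ area 1) :
    HasDerivAt cosIntegral (cosPeriod (energyOfArea u) / period (energyOfArea u)) u :=
  (hasDerivAt_cosArea (neg_one_lt_energyOfArea hu) (energyOfArea_ne_one hu.le h)).comp u
    (hasDerivAt_energyOfArea hu h)

lemma hasDerivAt_energyIntegral (u : ℝ) : HasDerivAt energyIntegral (energyOfArea u) u :=
  continuous_energyOfArea.integral_hasStrictDerivAt 0 u |>.hasDerivAt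

/-- Both sides vanish at `0` and have the same derivative in the area, by `area_eq`; the separatrix
area is a countable exception. -/
lemma energyIntegral_eq {u : ℝ} (hu : 0 ≤ u) :
    energyIntegral u = (u * energyOfArea u - 2 * cosIntegral u) / 3 := by
  have hc : Continuous fun u => (u * energyOfArea u - 2 * cosIntegral u) / 3 := by
    have h1 := continuous_energyOfArea
    have h2 := continuous_cosIntegral
    fun_prop
  have h := integral_eq_of_hasDerivAt_off_countable
    (fun u => (u * energyOfArea u - 2 * cosIntegral u) / 3) energyOfArea (a := 0) (b := u)
    (Set.countable_singleton (area 1)) hc.continuousOn (fun v hv => ?_)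
    (continuous_energyOfArea.intervalIntegrable _ _)
  · have hz : cosIntegral 0 = 0 := abs_nonpos_iff.1 (abs_cosIntegral_le le_rfl)
    simpa [hz, energyIntegral] using h
  · have hv0 : 0 < v := by simpa [hu] using hv.1.1
    have h0 := neg_one_lt_energyOfArea hv0
    have h1 := energyOfArea_ne_one hv0.le hv.2
    have hd := (((hasDerivAt_id v).mul (hasDerivAt_energyOfArea hv0 hv.2)).sub
      ((hasDerivAt_cosIntegral hv0 hv.2).const_mul 2)).div_const 3
    refine hd.congr_deriv ?_
    have hA := area_eq h0 h1
    rw [area_energyOfArea hv0.le] at hA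
    have hp := (period_pos h0 h1).ne'
    simp only [id]
    nth_rewrite 2 [hA]
    field_simp
    ring

/-! ### Dependence on `m` at fixed area -/

/-- The integral of the energy over the sublevel set of area `s` in the potential
`-m cos`. -/
noncomputable def energyProfile (s m : ℝ) : ℝ := m * √m * energyIntegral (s / √m)

/-- The integral of `cos θ` over the sublevel set of area `s` in the potential `-m cos`. -/
noncomputable def cosProfile (s m : ℝ) : ℝ := √m * cosIntegral (s / √m)

lemma abs_cosProfile_le {s m : ℝ} (hs : 0 ≤ s) (hm : 0 < m) : |cosProfile s m| ≤ s := by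
  have hr := Real.sqrt_pos.2 hm
  rw [cosProfile, abs_mul, abs_of_pos hr]
  have := abs_cosIntegral_le (u := s / √m) (by positivity)
  calc √m * |cosIntegral (s / √m)| ≤ √m * (s / √m) := by gcongr
    _ = s := by field_simp

lemma hasDerivAt_div_sqrt {m : ℝ} (hm : 0 < m) (s : ℝ) :
    HasDerivAt (fun m => s / √m) (-(s * (1 / (2 * √m))) / √m ^ 2) m := by
  have h := (hasDerivAt_const m s).div (Real.hasDerivAt_sqrt hm.ne') (Real.sqrt_pos.2 hm).ne'
  refine h.congr_deriv ?_
  ring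

/-- After `energyIntegral_eq` the terms containing `energyOfArea` cancel: this is the absence of a
boundary contribution at fixed area. -/
lemma hasDerivAt_energyProfile {s m : ℝ} (hs : 0 ≤ s) (hm : 0 < m) :
    HasDerivAt (energyProfile s) (-cosProfile s m) m := by
  have hr := Real.sqrt_pos.2 hm
  have h := ((hasDerivAt_id m).mul (Real.hasDerivAt_sqrt hm.ne')).mul
    ((hasDerivAt_energyIntegral (s / √m)).comp m (hasDerivAt_div_sqrt hm s))
  refine h.congr_deriv ?_
  have hsq := Real.sq_sqrt hm.le
  simp only [Function.comp, id, cosProfile, Pi.mul_apply]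
  rw [energyIntegral_eq (by positivity)]
  clear h
  generalize √m = r at hr hsq ⊢
  subst hsq
  field_simp
  ring

/-- With `u = s / √m` and `c = cosIntegral`, the product rule gives `(c(u) - u c'(u)) / (2 √m)`, and
`cosArea_sub` identifies the numerator as twice the variance. -/
lemma hasDerivAt_cosProfile {s m : ℝ} (hs : 0 < s) (hm : 0 < m) (h : s / √m ≠ area 1) :
    HasDerivAt (cosProfile s) (cosVariance (energyOfArea (s / √m)) / √m) m := by
  have hr := Real.sqrt_pos.2 hm
  have hu : 0 < s / √m := by positivity
  have hd := (Real.hasDerivAt_sqrt hm.ne').mul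
    ((hasDerivAt_cosIntegral hu h).comp m (hasDerivAt_div_sqrt hm s))
  refine hd.congr_deriv ?_
  have key := cosArea_sub (neg_one_lt_energyOfArea hu) (energyOfArea_ne_one hu.le h)
  rw [area_energyOfArea hu.le] at key
  have : cosVariance (energyOfArea (s / √m)) = (cosIntegral (s / √m) - s / √m *
    (cosPeriod (energyOfArea (s / √m)) / period (energyOfArea (s / √m)))) / 2 := by
    rw [cosIntegral, key]; ring
  rw [this]
  simp only [Function.comp]
  field_simp
  ring

/-- The fundamental theorem of calculus tolerates countably many exceptional points, here the
parameter at which a set of given area reaches the separatrix. -/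
lemma lipschitzOnWith_of_hasDerivAt_off_countable {f : ℝ → ℝ} {s t : Set ℝ} {C : NNReal}
    (hs : Convex ℝ s) (ht : t.Countable) (hf : ContinuousOn f s)
    (hd : ∀ x ∈ s \ t, DifferentiableAt ℝ f x ∧ |deriv f x| ≤ C) : LipschitzOnWith C f s := by
  refine LipschitzOnWith.of_dist_le_mul fun x hx y hy => ?_
  have hsub : Set.uIcc y x ⊆ s := hs.ordConnected.uIcc_subset hy hx
  have hae : ∀ᵐ z : ℝ, z ∉ t := measure_eq_zero_iff_ae_notMem.1 (ht.measure_zero volume)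
  have hbound : ∀ᵐ z : ℝ, z ∈ Set.uIoc y x → ‖deriv f z‖ ≤ C := by
    filter_upwards [hae] with z hz hz'
    exact (hd z ⟨hsub (Set.uIoc_subset_uIcc hz'), hz⟩).2
  have hint : IntervalIntegrable (deriv f) volume y x := by
    refine (intervalIntegrable_const (c := (C : ℝ))).mono_fun
      (measurable_deriv f).aestronglyMeasurable ?_
    rw [Filter.EventuallyLE, ae_restrict_iff' measurableSet_uIoc]
    filter_upwards [hbound] with z hz hz'
    exact (hz hz').trans (le_abs_self _)
  have h := integral_eq_of_hasDerivAt_off_countable f (deriv f) ht (hf.mono hsub)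
    (fun z hz => (hd z ⟨hsub (Set.Ioo_subset_Icc_self hz.1), hz.2⟩).1.hasDerivAt) hint
  rw [Real.dist_eq, Real.dist_eq, ← h]
  exact intervalIntegral.norm_integral_le_of_norm_le_const_ae hbound

lemma lipschitzOnWith_cosProfile {s a : ℝ} (hs : 0 < s) (ha : 0 < a) :
    LipschitzOnWith (Real.nnabs (8 * Real.pi / √a)) (cosProfile s) (Set.Ioi a) := by
  -- The excluded parameter solves `s / √m = area 1`.
  refine lipschitzOnWith_of_hasDerivAt_off_countable (convex_Ioi a)
    (Set.countable_singleton ((s / area 1) ^ 2)) ?_ ?_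
  · intro m hm
    have hr : √m ≠ 0 := (Real.sqrt_pos.2 (ha.trans hm)).ne'
    exact (ContinuousAt.mul (by fun_prop) (continuous_cosIntegral.continuousAt.comp
      (ContinuousAt.div (by fun_prop) (by fun_prop) hr))).continuousWithinAt
  · rintro m ⟨hm, hne⟩
    have hm0 : 0 < m := ha.trans hm
    have hr := Real.sqrt_pos.2 hm0
    have h1 : s / √m ≠ area 1 := by
      intro h
      refine hne ?_
      rw [Set.mem_singleton_iff, ← h, div_div_cancel₀ hs.ne', Real.sq_sqrt hm0.le]
    have hu : 0 < s / √m := by positivity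
    have hd := hasDerivAt_cosProfile hs hm0 h1
    have hE := neg_one_lt_energyOfArea hu
    have hE1 := energyOfArea_ne_one hu.le h1
    refine ⟨hd.differentiableAt, ?_⟩
    rw [hd.deriv, Real.coe_nnabs, abs_div, abs_of_nonneg (cosVariance_nonneg hE hE1),
      abs_of_pos hr, abs_of_nonneg (by positivity)]
    have := cosVariance_le hE hE1
    have hra := Real.sqrt_pos.2 ha
    have := Real.sqrt_le_sqrt (le_of_lt hm)
    gcongr


/-! ### Sublevel sets in phase space, by rescaling -/

instance : SFinite phase := by unfold phase; infer_instance

lemma measurable_energy (m : ℝ) : Measurable (energy (cosPotential m)) := by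
  unfold energy cosPotential; fun_prop

lemma energy_ge {m : ℝ} (hm : 0 ≤ m) (p : ℝ × ℝ) : -m ≤ energy (cosPotential m) p := by
  unfold energy cosPotential
  nlinarith [Real.cos_le_one p.1, sq_nonneg p.2]

lemma energy_sub_le (m m' : ℝ) (p : ℝ × ℝ) :
    energy (cosPotential m) p ≤ energy (cosPotential m') p + |m - m'| := by
  unfold energy cosPotential
  have h : |(m' - m) * Real.cos p.1| ≤ |m - m'| := by
    rw [abs_mul, abs_sub_comm]
    exact mul_le_of_le_one_right (abs_nonneg _) (Real.abs_cos_le_one _)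
  have := (abs_le.1 h).2
  linarith

lemma measurableSet_sublevel (m e : ℝ) : MeasurableSet {p | energy (cosPotential m) p < e} :=
  measurableSet_lt (measurable_energy m) measurable_const

section Sublevel

variable {m : ℝ} (hm : 0 < m)
include hm

lemma energy_lt_iff (x : ℝ) (p : ℝ × ℝ) : energy (cosPotential m) p < m * x ↔
    p.2 ∈ Set.Ioo (-(√m * speed x p.1)) (√m * speed x p.1) := by
  have hw := speed_nonneg x p.1
  rw [Set.mem_Ioo, ← abs_lt, ← abs_of_nonneg (by positivity : 0 ≤ √m * speed x p.1), ← sq_lt_sq,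
    mul_pow, Real.sq_sqrt hm.le, energy, cosPotential]
  rcases le_or_gt 0 (x + Real.cos p.1) with h | h
  · rw [sq_speed h]
    constructor <;> intro h' <;> nlinarith
  · rw [speed_eq_zero h.le]
    constructor <;> intro h' <;> nlinarith [sq_nonneg p.2]

lemma phase_sublevel (x : ℝ) :
    phase {p | energy (cosPotential m) p < m * x} = ENNReal.ofReal (√m * area x) := by
  have hc : Continuous fun θ => √m * (1 * (2 * speed x θ)) := by
    have := continuous_speed_right x
    fun_prop
  have hpi : 0 ≤ 2 * Real.pi := by positivity
  rw [phase, Measure.prod_apply (measurableSet_sublevel m _), area, weightedArea,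
    ← intervalIntegral.integral_const_mul, intervalIntegral.integral_of_le hpi,
    ← integral_Icc_eq_integral_Ioc, ofReal_integral_eq_lintegral_ofReal]
  · refine lintegral_congr fun θ => ?_
    have : Prod.mk θ ⁻¹' {p | energy (cosPotential m) p < m * x} =
        Set.Ioo (-(√m * speed x θ)) (√m * speed x θ) := by
      ext v; exact energy_lt_iff hm x (θ, v)
    rw [this, Real.volume_Ioo]
    congr 1; ring
  · exact hc.integrableOn_Icc
  · exact Filter.Eventually.of_forall fun θ => by
      have := speed_nonneg x θ
      positivity

lemma phase_sublevel' (e : ℝ) :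
    phase {p | energy (cosPotential m) p < e} = ENNReal.ofReal (√m * area (e / m)) := by
  rw [← phase_sublevel hm, mul_div_cancel₀ _ hm.ne']

lemma sublevelArea_eq (e : ℝ) : sublevelArea (cosPotential m) e = √m * area (e / m) := by
  rw [sublevelArea, phase_sublevel' hm, ENNReal.toReal_ofReal]
  exact mul_nonneg (Real.sqrt_nonneg _) (area_nonneg _)

lemma phase_sublevel_lt_top (e : ℝ) : phase {p | energy (cosPotential m) p < e} < ⊤ := by
  rw [phase_sublevel' hm]; exact ENNReal.ofReal_lt_top

lemma setIntegral_sublevel {g : ℝ × ℝ → ℝ} (x : ℝ)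
    (hg : IntegrableOn g {p | energy (cosPotential m) p < m * x} phase) :
    ∫ p in {p | energy (cosPotential m) p < m * x}, g p ∂phase =
      ∫ θ in (0 : ℝ)..(2 * Real.pi),
        ∫ v in (-(√m * speed x θ))..(√m * speed x θ), g (θ, v) := by
  have hS := measurableSet_sublevel m (m * x)
  rw [← integral_indicator hS]
  rw [← integrable_indicator_iff hS] at hg
  unfold phase at hg ⊢
  rw [integral_prod _ hg, intervalIntegral.integral_of_le (by positivity),
    ← integral_Icc_eq_integral_Ioc]
  refine setIntegral_congr_fun measurableSet_Icc fun θ _ => ?_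
  have hw := speed_nonneg x θ
  have hr := Real.sqrt_nonneg m
  rw [intervalIntegral.integral_of_le (by nlinarith), integral_Ioc_eq_integral_Ioo,
    ← integral_indicator measurableSet_Ioo]
  refine integral_congr_ae (Filter.Eventually.of_forall fun v => ?_)
  have h := energy_lt_iff hm x (θ, v)
  by_cases hv : v ∈ Set.Ioo (-(√m * speed x θ)) (√m * speed x θ)
  · have hv' : (θ, v) ∈ {p | energy (cosPotential m) p < m * x} := h.2 hv
    simp only [Set.indicator_of_mem hv, Set.indicator_of_mem hv']
  · have hv' : (θ, v) ∉ {p | energy (cosPotential m) p < m * x} := fun h' => hv (h.1 h')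
    simp only [Set.indicator_of_notMem hv, Set.indicator_of_notMem hv']

lemma integrableOn_sublevel_of_bounded {g : ℝ × ℝ → ℝ} (hg : Measurable g) (e C : ℝ)
    (hC : ∀ p, energy (cosPotential m) p < e → |g p| ≤ C) :
    IntegrableOn g {p | energy (cosPotential m) p < e} phase := by
  refine Measure.integrableOn_of_bounded (M := C) (phase_sublevel_lt_top hm e).ne
    hg.aestronglyMeasurable ?_
  rw [ae_restrict_iff' (measurableSet_sublevel m e)]
  exact Filter.Eventually.of_forall hC

lemma setIntegral_one_sublevel (e : ℝ) :
    ∫ _ in {p | energy (cosPotential m) p < e}, (1 : ℝ) ∂phase = √m * area (e / m) := by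
  rw [setIntegral_const, smul_eq_mul, mul_one, ← sublevelArea_eq hm]
  rfl

lemma setIntegral_cos_sublevel {s : ℝ} :
    ∫ p in {p | energy (cosPotential m) p < m * energyOfArea (s / √m)}, Real.cos p.1 ∂phase =
      cosProfile s m := by
  rw [setIntegral_sublevel hm _ (integrableOn_sublevel_of_bounded hm (by fun_prop) _ 1
    fun p _ => Real.abs_cos_le_one _), cosProfile, cosIntegral, cosArea, weightedArea,
    ← intervalIntegral.integral_const_mul]
  refine intervalIntegral.integral_congr fun θ _ => ?_
  simp only
  rw [intervalIntegral.integral_const, smul_eq_mul]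
  ring

lemma setIntegral_energy_sublevel {s : ℝ} (hs : 0 ≤ s) :
    ∫ p in {p | energy (cosPotential m) p < m * energyOfArea (s / √m)},
      energy (cosPotential m) p ∂phase = energyProfile s m := by
  have hr := Real.sqrt_pos.2 hm
  set x := energyOfArea (s / √m) with hx
  have hI : IntegrableOn (energy (cosPotential m)) {p | energy (cosPotential m) p < m * x} phase := by
    refine integrableOn_sublevel_of_bounded hm (measurable_energy m) _ (m + |m * x|) fun p hp => ?_
    have h1 := energy_ge hm.le p
    have h2 := le_abs_self (m * x)
    have h3 := abs_nonneg (m * x)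
    exact abs_le.2 ⟨by linarith, by linarith⟩
  have hc1 : Continuous fun θ => (1 : ℝ) * (2 * speed x θ) := by
    have := continuous_speed_right x
    fun_prop
  have hc2 : Continuous fun θ => Real.cos θ * (2 * speed x θ) := by
    have := continuous_speed_right x
    fun_prop
  rw [setIntegral_sublevel hm _ hI, energyProfile, energyIntegral_eq (by positivity), cosIntegral,
    ← hx, ← area_energyOfArea (by positivity : 0 ≤ s / √m), ← hx,
    show m * √m * ((area x * x - 2 * cosArea x) / 3) =
      m * √m * x / 3 * area x - m * √m * (2 / 3) * cosArea x by ring, area, cosArea, weightedArea,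
    weightedArea, ← intervalIntegral.integral_const_mul, ← intervalIntegral.integral_const_mul,
    ← intervalIntegral.integral_sub ((hc1.intervalIntegrable _ _).const_mul _)
      ((hc2.intervalIntegrable _ _).const_mul _)]
  refine intervalIntegral.integral_congr fun θ _ => ?_
  simp only [energy, cosPotential]
  rw [intervalIntegral.integral_add (Continuous.intervalIntegrable (by fun_prop) _ _)
    (by simp), intervalIntegral.integral_div, integral_pow, intervalIntegral.integral_const,
    smul_eq_mul]
  -- The cubes come from integrating `v² / 2`; lowering them yields the combination of areas in
  -- `energyIntegral_eq`.
  have h3 : speed x θ ^ 3 = 2 * (x + Real.cos θ) * speed x θ := by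
    rcases le_or_gt 0 (x + Real.cos θ) with h | h
    · rw [← sq_speed h]; ring
    · rw [speed_eq_zero h.le]; ring
  have h4 : √m ^ 3 = m * √m := by
    rw [pow_succ, Real.sq_sqrt hm.le]
  norm_num
  rw [show (-(√m * speed x θ)) ^ 3 = -(√m ^ 3 * speed x θ ^ 3) by ring, mul_pow, h3, h4]
  ring

end Sublevel

lemma phase_sublevel_lt_top_of_real (m e : ℝ) :
    phase {p | energy (cosPotential m) p < e} < ⊤ := by
  refine (measure_mono fun p hp => ?_).trans_lt (phase_sublevel_lt_top one_pos (e + |1 - m|))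
  have := energy_sub_le 1 m p
  simp only [Set.mem_ofPred_eq] at hp ⊢
  linarith

lemma sublevelArea_mono (m : ℝ) : Monotone (sublevelArea (cosPotential m)) := by
  intro a b hab
  exact ENNReal.toReal_mono (phase_sublevel_lt_top_of_real m b).ne
    (measure_mono fun p hp => lt_of_lt_of_le hp hab)

lemma sublevelArea_sub_le (m m' e : ℝ) :
    sublevelArea (cosPotential m') (e - |m - m'|) ≤ sublevelArea (cosPotential m) e := by
  refine ENNReal.toReal_mono (phase_sublevel_lt_top_of_real m e).ne (measure_mono fun p hp => ?_)
  have := energy_sub_le m m' p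
  simp only [Set.mem_ofPred_eq] at hp ⊢
  linarith

lemma lt_area_iff {u y : ℝ} (hu : 0 ≤ u) : u < area y ↔ energyOfArea u < y := by
  have h1 : -1 ≤ energyOfArea u := by
    rw [← strictMono_areaExt.le_iff_le, areaExt_energyOfArea, areaExt_of_le le_rfl,
      area_eq_zero le_rfl]
    exact hu
  constructor
  · intro h
    by_contra! h'
    linarith [area_mono h', area_energyOfArea hu]
  · intro h
    exact (area_energyOfArea hu).symm.trans_lt (area_lt_area h1 h)

lemma le_energyOfArea_area (y : ℝ) : y ≤ energyOfArea (area y) := by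
  rcases le_total (-1) y with h | h
  · rw [energyOfArea_area h]
  · rw [area_eq_zero h, ← area_eq_zero (le_refl (-1)), energyOfArea_area le_rfl]
    exact h


/-! ### The profile measure and the rearrangement -/

/-- The measure `|F'(η)| dη` on `{η : -m₀ < η < e_*}`. -/
noncomputable def profileMeasure (F : ℝ → ℝ) (eStar : EReal) (m₀ : ℝ) : Measure ℝ :=
  (volume.restrict (Set.Ioi (-m₀) ∩ {η : ℝ | (η : EReal) < eStar})).withDensity
    fun η => ENNReal.ofReal (-deriv F η)

lemma ae_profileMeasure {F : ℝ → ℝ} {eStar : EReal} {m₀ : ℝ} {P : ℝ → Prop}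
    (h : ∀ᵐ η : ℝ, -m₀ < η → P η) : ∀ᵐ η ∂profileMeasure F eStar m₀, P η := by
  refine (withDensity_absolutelyContinuous _ _).ae_le ?_
  refine ae_mono (Measure.restrict_mono_set _ Set.inter_subset_left) ?_
  exact (ae_restrict_iff' measurableSet_Ioi).2 h

lemma measurableSet_lt_eStar (eStar : EReal) : MeasurableSet {η : ℝ | (η : EReal) < eStar} :=
  measurableSet_lt measurable_coe_real_ereal measurable_const

namespace IsSteadyState

variable {F : ℝ → ℝ} {eStar : EReal} {m₀ : ℝ} (hF : IsSteadyState F eStar m₀)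
include hF

lemma hasDerivAt {e : ℝ} (he : (e : EReal) < eStar) : HasDerivAt F (deriv F e) e :=
  (differentiableAt_of_deriv_ne_zero (hF.deriv_neg e he).ne).hasDerivAt

lemma antitone : Antitone F := by
  induction eStar using EReal.rec with
  | bot => exact absurd rfl hF.eStar_ne_bot
  | top =>
    exact antitone_of_deriv_nonpos (fun e => (hF.hasDerivAt (EReal.coe_lt_top e)).differentiableAt)
      fun e => (hF.deriv_neg e (EReal.coe_lt_top e)).le
  | coe c =>
    refine AntitoneOn.Iic_union_Ici (a := c) ?_ ?_
    · refine antitoneOn_of_deriv_nonpos (convex_Iic c) hF.continuous.continuousOn ?_ ?_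
      all_goals
        rw [interior_Iic]
        intro e he
      · exact (hF.hasDerivAt (EReal.coe_lt_coe_iff.2 he)).differentiableAt.differentiableWithinAt
      · exact (hF.deriv_neg e (EReal.coe_lt_coe_iff.2 he)).le
    · intro a ha b hb _
      rw [hF.eq_zero a (EReal.coe_le_coe_iff.2 ha), hF.eq_zero b (EReal.coe_le_coe_iff.2 hb)]

lemma nonneg (e : ℝ) : 0 ≤ F e := by
  induction eStar using EReal.rec with
  | bot => exact absurd rfl hF.eStar_ne_bot
  | top => exact hF.antitone.le_of_tendsto (hF.tendsto_zero rfl) e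
  | coe c =>
    rw [← hF.eq_zero (max e c) (EReal.coe_le_coe_iff.2 (le_max_right _ _))]
    exact hF.antitone (le_max_left _ _)

/-- `F` vanishes at the cut-off or at infinity, so the integral of `-F'` telescopes to `F ε`; the
sign of `F'` provides integrability. -/
lemma profileMeasure_Ioi {ε : ℝ} (hε : -m₀ ≤ ε) :
    profileMeasure F eStar m₀ (Set.Ioi ε) = ENNReal.ofReal (F ε) := by
  rw [profileMeasure, withDensity_apply _ measurableSet_Ioi,
    Measure.restrict_restrict measurableSet_Ioi, ← Set.inter_assoc,
    Set.inter_eq_left.2 (Set.Ioi_subset_Ioi hε)]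
  induction eStar using EReal.rec with
  | bot => exact absurd rfl hF.eStar_ne_bot
  | top =>
    have hs : Set.Ioi ε ∩ {η : ℝ | (η : EReal) < ⊤} = Set.Ioi ε :=
      Set.inter_eq_left.2 fun η _ => EReal.coe_lt_top η
    have hd : ∀ e ∈ Set.Ioi ε, HasDerivAt F (deriv F e) e :=
      fun e _ => hF.hasDerivAt (EReal.coe_lt_top e)
    have hn : ∀ e ∈ Set.Ioi ε, deriv F e ≤ 0 := fun e _ => (hF.deriv_neg e (EReal.coe_lt_top e)).le
    have hc := hF.continuous.continuousWithinAt (s := Set.Ici ε) (x := ε)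
    have hi := integrableOn_Ioi_deriv_of_nonpos hc hd hn (hF.tendsto_zero rfl)
    rw [hs, ← ofReal_integral_eq_lintegral_ofReal (f := fun e => -deriv F e) hi.neg, integral_neg,
      integral_Ioi_of_hasDerivAt_of_nonpos hc hd hn (hF.tendsto_zero rfl)]
    · simp
    · refine (ae_restrict_iff' measurableSet_Ioi).2 (Filter.Eventually.of_forall fun e he => ?_)
      simpa using hn e he
  | coe c =>
    have hs : Set.Ioi ε ∩ {η : ℝ | (η : EReal) < (c : EReal)} = Set.Ioo ε c := by
      ext η; simp
    rw [hs]
    rcases le_or_gt c ε with h | h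
    · rw [Set.Ioo_eq_empty (not_lt.2 h), hF.eq_zero ε (EReal.coe_le_coe_iff.2 h)]
      simp
    · have hd : ∀ e ∈ Set.Ioo ε c, HasDerivAt (fun e => -F e) (-deriv F e) e :=
        fun e he => (hF.hasDerivAt (EReal.coe_lt_coe_iff.2 he.2)).neg
      have hn : ∀ e ∈ Set.Ioo ε c, 0 ≤ -deriv F e :=
        fun e he => neg_nonneg.2 (hF.deriv_neg e (EReal.coe_lt_coe_iff.2 he.2)).le
      have hc : ContinuousOn (fun e => -F e) (Set.Icc ε c) := hF.continuous.neg.continuousOn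
      have hi := intervalIntegral.integrableOn_deriv_of_nonneg hc hd hn
      have hv := intervalIntegral.integral_eq_sub_of_hasDerivAt_of_le h.le hc hd
        ((intervalIntegrable_iff_integrableOn_Ioc_of_le h.le).2 hi)
      rw [intervalIntegral.integral_of_le h.le, integral_Ioc_eq_integral_Ioo,
        hF.eq_zero c le_rfl] at hv
      rw [← ofReal_integral_eq_lintegral_ofReal (hi.mono_set Set.Ioo_subset_Ioc_self), hv]
      · simp
      · exact (ae_restrict_iff' measurableSet_Ioo).2 (Filter.Eventually.of_forall hn)

lemma isFiniteMeasure_profileMeasure : IsFiniteMeasure (profileMeasure F eStar m₀) := by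
  refine ⟨?_⟩
  have h0 : profileMeasure F eStar m₀ (Set.Iic (-m₀)) = 0 := by
    have : ∀ᵐ η ∂profileMeasure F eStar m₀, ¬ η ∈ Set.Iic (-m₀) :=
      ae_profileMeasure (Filter.Eventually.of_forall fun η h => not_le.2 h)
    exact measure_eq_zero_iff_ae_notMem.2 this
  rw [← Set.Iic_union_Ioi (a := -m₀)]
  refine (measure_union_le _ _).trans_lt ?_
  rw [h0, hF.profileMeasure_Ioi le_rfl, zero_add]
  exact ENNReal.ofReal_lt_top

lemma measureReal_profileMeasure_Ioi {ε : ℝ} (hε : -m₀ ≤ ε) :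
    (profileMeasure F eStar m₀).real (Set.Ioi ε) = F ε := by
  rw [measureReal_def, hF.profileMeasure_Ioi hε, ENNReal.toReal_ofReal (hF.nonneg ε)]

/-- If `t < F (m₀ * x)`, continuity gives `t < F (m₀ * y)` for some `y > x`, so `{f₀ > t}` contains
a strictly larger sublevel set. If `t ≥ F (m₀ * x)`, monotonicity puts `{f₀ > t}` inside the
sublevel set at `m₀ * x`. -/
lemma sharp_area {x : ℝ} (hx : -1 ≤ x) :
    sharp (steadyState F m₀) (√m₀ * area x) = F (m₀ * x) := by
  have hm := hF.m₀_pos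
  have hr := Real.sqrt_pos.2 hm
  have hset : {t : ℝ | 0 ≤ t ∧ distrib (steadyState F m₀) t ≤ ENNReal.ofReal (√m₀ * area x)} =
      Set.Ici (F (m₀ * x)) := by
    ext t
    constructor
    · rintro ⟨ht, h⟩
      by_contra h'
      have h' : t < F (m₀ * x) := not_le.1 h'
      have hev : ∀ᶠ y in nhdsWithin x (Set.Ioi x), t < F (m₀ * y) := by
        have hc : ContinuousAt (fun y => F (m₀ * y)) x :=
          (hF.continuous.comp (continuous_const.mul continuous_id)).continuousAt
        exact (hc.eventually (lt_mem_nhds h')).filter_mono nhdsWithin_le_nhds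
      obtain ⟨y, hy, hxy⟩ := (hev.and self_mem_nhdsWithin).exists
      have h2 : ENNReal.ofReal (√m₀ * area y) ≤ ENNReal.ofReal (√m₀ * area x) := by
        rw [← phase_sublevel hm]
        refine (measure_mono fun p hp => ?_).trans h
        exact hy.trans_le (hF.antitone (le_of_lt hp))
      have h3 := (ENNReal.ofReal_le_ofReal_iff (mul_nonneg hr.le (area_nonneg x))).1 h2
      have h4 := le_of_mul_le_mul_left h3 hr
      exact absurd (area_lt_area hx hxy) (not_lt.2 h4)
    · intro h
      have h : F (m₀ * x) ≤ t := h
      refine ⟨(hF.nonneg _).trans h, ?_⟩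
      rw [← phase_sublevel hm]
      refine measure_mono fun p hp => ?_
      by_contra hp'
      exact absurd ((hF.antitone (not_lt.1 hp')).trans h) (not_le.2 hp)
  rw [sharp, hset, csInf_Ici]

lemma sharp_eq {s : ℝ} (hs : 0 ≤ s) :
    sharp (steadyState F m₀) s = F (m₀ * energyOfArea (s / √m₀)) := by
  have hr := Real.sqrt_pos.2 hF.m₀_pos
  have hu : 0 ≤ s / √m₀ := by positivity
  have h1 : -1 ≤ energyOfArea (s / √m₀) := by
    rw [← strictMono_areaExt.le_iff_le, areaExt_energyOfArea, areaExt_of_le le_rfl,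
      area_eq_zero le_rfl]
    exact hu
  rw [← hF.sharp_area h1, area_energyOfArea hu, mul_div_cancel₀ _ hr.ne']

lemma sharp_eq_max (s : ℝ) :
    sharp (steadyState F m₀) s = F (m₀ * energyOfArea (max s 0 / √m₀)) := by
  rw [← hF.sharp_eq (le_max_right s 0), sharp, sharp]
  have : ENNReal.ofReal (max s 0) = ENNReal.ofReal s := by
    rcases le_total s 0 with h | h
    · rw [max_eq_right h, ENNReal.ofReal_zero, ENNReal.ofReal_of_nonpos h]
    · rw [max_eq_left h]
  rw [this]

lemma continuous_sharp : Continuous (sharp (steadyState F m₀)) := by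
  rw [funext hF.sharp_eq_max]
  have := continuous_energyOfArea
  exact hF.continuous.comp (by fun_prop)

lemma measurable_rearrangement (m : ℝ) :
    Measurable (rearrangement (steadyState F m₀) (cosPotential m)) :=
  hF.continuous_sharp.measurable.comp ((sublevelArea_mono m).measurable.comp (measurable_energy m))

lemma sharp_eq_measure {s : ℝ} (hs : 0 ≤ s) :
    sharp (steadyState F m₀) s =
      (profileMeasure F eStar m₀).real {η | s < √m₀ * area (η / m₀)} := by
  have hm := hF.m₀_pos
  have hr := Real.sqrt_pos.2 hm
  have hu : 0 ≤ s / √m₀ := by positivity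
  have h1 : -1 ≤ energyOfArea (s / √m₀) := by
    rw [← strictMono_areaExt.le_iff_le, areaExt_energyOfArea, areaExt_of_le le_rfl,
      area_eq_zero le_rfl]
    exact hu
  rw [hF.sharp_eq hs, ← hF.measureReal_profileMeasure_Ioi (by nlinarith)]
  congr 1
  ext η
  rw [Set.mem_Ioi, Set.mem_ofPred_eq, ← div_lt_iff₀' hr, lt_area_iff hu, lt_div_iff₀' hm]

lemma rearrangement_nonneg (m : ℝ) (p : ℝ × ℝ) :
    0 ≤ rearrangement (steadyState F m₀) (cosPotential m) p := by
  rw [rearrangement, hF.sharp_eq_max]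
  exact hF.nonneg _

/-- The discrepancy `|m - m₀|` is paid twice: in comparing sublevel areas, then in comparing the
energies of the point. -/
lemma rearrangement_le (m : ℝ) (p : ℝ × ℝ) :
    rearrangement (steadyState F m₀) (cosPotential m) p ≤
      F (energy (cosPotential m₀) p - 2 * |m - m₀|) := by
  have hm := hF.m₀_pos
  have hr := Real.sqrt_pos.2 hm
  set e := energy (cosPotential m) p with he
  have h1 : √m₀ * area ((e - |m - m₀|) / m₀) ≤ sublevelArea (cosPotential m) e := by
    rw [← sublevelArea_eq hm]; exact sublevelArea_sub_le m m₀ e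
  have h2 : (e - |m - m₀|) / m₀ ≤ energyOfArea (sublevelArea (cosPotential m) e / √m₀) := by
    refine (le_energyOfArea_area _).trans (areaIso.symm.monotone ?_)
    rw [le_div_iff₀' hr]
    exact h1
  rw [rearrangement, ← he, hF.sharp_eq (s := sublevelArea (cosPotential m) e)
    ENNReal.toReal_nonneg]
  refine hF.antitone ?_
  rw [div_le_iff₀' hm] at h2
  have h3 := energy_sub_le m₀ m p
  rw [abs_sub_comm] at h3
  linarith

lemma rearrangement_self (p : ℝ × ℝ) :
    rearrangement (steadyState F m₀) (cosPotential m₀) p = steadyState F m₀ p := by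
  have hm := hF.m₀_pos
  have h := energy_ge hm.le p
  rw [rearrangement, sublevelArea_eq hm, hF.sharp_area, mul_div_cancel₀ _ hm.ne', steadyState]
  rw [le_div_iff₀ hm]; linarith

end IsSteadyState

/-! ### Integrability of the rearranged density -/

lemma abs_energy_le (m : ℝ) (p : ℝ × ℝ) :
    |energy (cosPotential m) p| ≤ (1 + |m|) * (1 + p.2 ^ 2) := by
  have h1 : |m * Real.cos p.1| ≤ |m| := by
    rw [abs_mul]; exact mul_le_of_le_one_right (abs_nonneg _) (Real.abs_cos_le_one _)
  have h2 := abs_le.1 h1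
  have h3 := sq_nonneg p.2
  have h4 := abs_nonneg m
  unfold energy cosPotential
  rw [abs_le]
  constructor <;> nlinarith

lemma integrable_comp_half {g : ℝ × ℝ → ℝ} (hg : Integrable g phase) :
    Integrable (fun p : ℝ × ℝ => g (p.1, p.2 * 2⁻¹)) phase := by
  have hmeas : Measurable fun v : ℝ => v * 2⁻¹ := measurable_id.mul_const _
  have hmap : phase.map (Prod.map id fun v : ℝ => v * 2⁻¹) = ENNReal.ofReal 2 • phase := by
    unfold phase
    rw [← Measure.map_prod_map _ _ measurable_id hmeas, Measure.map_id,
      Real.map_volume_mul_right (by norm_num), Measure.prod_smul_right]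
    simp
  have h : Integrable g (phase.map (Prod.map id fun v : ℝ => v * 2⁻¹)) := by
    rw [hmap]; exact hg.smul_measure ENNReal.ofReal_ne_top
  exact h.comp_measurable (measurable_id.prodMap hmeas)

namespace IsSteadyState

variable {F : ℝ → ℝ} {eStar : EReal} {m₀ : ℝ} (hF : IsSteadyState F eStar m₀)
include hF

/-- For large `|v|` the shifted profile lies below `f₀(θ, v / 2)`, integrable with its second
moment; for bounded `v` it is bounded on a set of finite measure. -/
lemma integrable_shift (c : ℝ) (hc : 0 ≤ c) :
    Integrable (fun p : ℝ × ℝ => (1 + p.2 ^ 2) * F (energy (cosPotential m₀) p - c)) phase := by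
  -- The condition `v² ≥ R²` is `v² / 2 - c ≥ (v / 2)² / 2`.
  set R := √(8 * c / 3)
  have hR : R ^ 2 = 8 * c / 3 := Real.sq_sqrt (by positivity)
  have h1 := (integrable_comp_half hF.energy_space).const_mul 4
  have h2 : Integrable (Set.indicator (Set.univ ×ˢ Set.Icc (-R) R)
      fun _ : ℝ × ℝ => (1 + R ^ 2) * F (-m₀ - c)) phase := by
    rw [integrable_indicator_iff (MeasurableSet.univ.prod measurableSet_Icc)]
    refine integrableOn_const ?_
    rw [phase, Measure.prod_prod]
    simp [ENNReal.mul_eq_top]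
  refine (h1.add h2).mono' ?_ (Filter.Eventually.of_forall fun p => ?_)
  · refine Measurable.aestronglyMeasurable (Measurable.mul (by fun_prop) ?_)
    exact hF.continuous.measurable.comp ((measurable_energy m₀).sub_const c)
  · have hn := hF.nonneg (energy (cosPotential m₀) p - c)
    rw [Real.norm_of_nonneg (by positivity)]
    have hn1 : 0 ≤ 4 * ((1 + (p.2 * 2⁻¹) ^ 2) * steadyState F m₀ (p.1, p.2 * 2⁻¹)) := by
      have := hF.nonneg (energy (cosPotential m₀) (p.1, p.2 * 2⁻¹))
      unfold steadyState
      positivity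
    have hn2 := hF.nonneg (-m₀ - c)
    by_cases hp : p.2 ^ 2 ≤ R ^ 2
    · have hmem : p ∈ Set.univ ×ˢ Set.Icc (-R) R :=
        ⟨trivial, abs_le_of_sq_le_sq' hp (Real.sqrt_nonneg _)⟩
      simp only [Pi.add_apply, Set.indicator_of_mem hmem]
      have hle : F (energy (cosPotential m₀) p - c) ≤ F (-m₀ - c) :=
        hF.antitone (by linarith [energy_ge hF.m₀_pos.le p])
      have : (1 + p.2 ^ 2) * F (energy (cosPotential m₀) p - c) ≤ (1 + R ^ 2) * F (-m₀ - c) := by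
        gcongr
      linarith
    · push Not at hp
      have hn3 : 0 ≤ Set.indicator (Set.univ ×ˢ Set.Icc (-R) R)
          (fun _ : ℝ × ℝ => (1 + R ^ 2) * F (-m₀ - c)) p :=
        Set.indicator_nonneg (fun _ _ => by positivity) _
      have hle : F (energy (cosPotential m₀) p - c) ≤ steadyState F m₀ (p.1, p.2 * 2⁻¹) := by
        refine hF.antitone ?_
        simp only [energy]
        nlinarith
      have : (1 + p.2 ^ 2) * F (energy (cosPotential m₀) p - c) ≤
          (4 * (1 + (p.2 * 2⁻¹) ^ 2)) * steadyState F m₀ (p.1, p.2 * 2⁻¹) :=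
        mul_le_mul (by nlinarith) hle hn (by positivity)
      simp only [Pi.add_apply]
      linarith

lemma integrable_mul_rearrangement (m : ℝ) {g : ℝ × ℝ → ℝ} (hg : Measurable g) (C : ℝ)
    (hC : ∀ p, |g p| ≤ C * (1 + p.2 ^ 2)) :
    Integrable (fun p => g p * rearrangement (steadyState F m₀) (cosPotential m) p) phase := by
  refine ((hF.integrable_shift (2 * |m - m₀|) (by positivity)).const_mul C).mono'
    (hg.mul (hF.measurable_rearrangement m)).aestronglyMeasurable
    (Filter.Eventually.of_forall fun p => ?_)
  have h1 := hF.rearrangement_nonneg m p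
  rw [norm_mul, Real.norm_of_nonneg h1, Real.norm_eq_abs, ← mul_assoc]
  exact mul_le_mul (hC p) (hF.rearrangement_le m p) h1 ((abs_nonneg _).trans (hC p))

lemma integrable_reducedEnergyIntegrand (m : ℝ) :
    Integrable (reducedEnergyIntegrand (steadyState F m₀) m) phase :=
  hF.integrable_mul_rearrangement m (measurable_energy m) _ (abs_energy_le m)

end IsSteadyState


/-! ### Layer-cake formula and derivatives of the reduced energy -/

/-- The energies `η` for which the sublevel set of `f₀` has larger area than that of `p` in the
potential `-m cos`. -/
def layerSet (m m₀ : ℝ) (p : ℝ × ℝ) : Set ℝ :=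
  {η | sublevelArea (cosPotential m) (energy (cosPotential m) p) < √m₀ * area (η / m₀)}

lemma measurableSet_layer (m m₀ : ℝ) :
    MeasurableSet {q : (ℝ × ℝ) × ℝ | q.2 ∈ layerSet m m₀ q.1} := by
  have h1 : Measurable fun q : (ℝ × ℝ) × ℝ =>
      sublevelArea (cosPotential m) (energy (cosPotential m) q.1) :=
    ((sublevelArea_mono m).measurable.comp (measurable_energy m)).comp measurable_fst
  have h2 : Measurable fun q : (ℝ × ℝ) × ℝ => √m₀ * area (q.2 / m₀) :=
    (continuous_const.mul (continuous_area.comp (continuous_snd.div_const _))).measurable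
  simpa only [layerSet, Set.mem_ofPred_eq] using measurableSet_lt h1 h2

lemma measurableSet_layerSet (m m₀ : ℝ) (p : ℝ × ℝ) : MeasurableSet (layerSet m m₀ p) :=
  measurableSet_lt measurable_const
    (continuous_const.mul (continuous_area.comp (continuous_id.div_const _))).measurable

namespace IsSteadyState

variable {F : ℝ → ℝ} {eStar : EReal} {m₀ : ℝ} (hF : IsSteadyState F eStar m₀)
include hF

lemma integral_indicator_layer (m : ℝ) (c : ℝ) (p : ℝ × ℝ) :
    ∫ η, (layerSet m m₀ p).indicator (fun _ => c) η ∂profileMeasure F eStar m₀ =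
    c * rearrangement (steadyState F m₀) (cosPotential m) p := by
  rw [integral_indicator (measurableSet_layerSet m m₀ p),
    setIntegral_const, rearrangement, hF.sharp_eq_measure
    (s := sublevelArea (cosPotential m) (energy (cosPotential m) p)) ENNReal.toReal_nonneg,
    smul_eq_mul, mul_comm]
  rfl

/-- Layer-cake decomposition of integrals against the rearrangement of the steady state. -/
lemma layer_cake {m : ℝ} (hm : 0 < m) {g : ℝ × ℝ → ℝ} (hg : Measurable g) (C : ℝ)
    (hC : ∀ p, |g p| ≤ C * (1 + p.2 ^ 2)) :
    Integrable (fun η => ∫ p in {p | energy (cosPotential m) p <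
        m * energyOfArea (√m₀ * area (η / m₀) / √m)}, g p ∂phase) (profileMeasure F eStar m₀) ∧
      ∫ p, g p * rearrangement (steadyState F m₀) (cosPotential m) p ∂phase =
        ∫ η, ∫ p in {p | energy (cosPotential m) p <
          m * energyOfArea (√m₀ * area (η / m₀) / √m)}, g p ∂phase ∂profileMeasure F eStar m₀ := by
  have hm₀ := hF.m₀_pos
  have hr := Real.sqrt_pos.2 hm
  have hr₀ := Real.sqrt_pos.2 hm₀
  have := hF.isFiniteMeasure_profileMeasure
  set μ := profileMeasure F eStar m₀
  set K : ℝ × ℝ → ℝ → ℝ := fun p => (layerSet m m₀ p).indicator fun _ => g p with hK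
  have hKi : Integrable (Function.uncurry K) (phase.prod μ) := by
    have hmeas : Measurable (Function.uncurry K) := by
      have heq : Function.uncurry K =
          {q : (ℝ × ℝ) × ℝ | q.2 ∈ layerSet m m₀ q.1}.indicator fun q => g q.1 := by
        funext q
        by_cases hq : q.2 ∈ layerSet m m₀ q.1
        · rw [Set.indicator_of_mem (by simpa only [Set.mem_ofPred_eq] using hq)]
          simp only [Function.uncurry, hK, Set.indicator_of_mem hq]
        · rw [Set.indicator_of_notMem (by simpa only [Set.mem_ofPred_eq] using hq)]
          simp only [Function.uncurry, hK, Set.indicator_of_notMem hq]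
      rw [heq]
      exact (hg.comp measurable_fst).indicator (measurableSet_layer m m₀)
    rw [integrable_prod_iff hmeas.aestronglyMeasurable]
    constructor
    · exact Filter.Eventually.of_forall fun p => (integrable_const (g p)).indicator
        (measurableSet_layerSet m m₀ p)
    -- Integrating the absolute value in `η` gives `|g|` times the rearrangement.
    · refine (hF.integrable_mul_rearrangement m hg.abs C (by simpa using hC)).congr
        (Filter.Eventually.of_forall fun p => ?_)
      simp only
      rw [← hF.integral_indicator_layer]
      refine integral_congr_ae (Filter.Eventually.of_forall fun η => ?_)
      simp only [Function.uncurry, hK, norm_indicator_eq_indicator_norm, Real.norm_eq_abs]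
  have hin : ∀ᵐ η ∂μ, ∫ p, K p η ∂phase = ∫ p in {p | energy (cosPotential m) p <
      m * energyOfArea (√m₀ * area (η / m₀) / √m)}, g p ∂phase := by
    refine ae_profileMeasure (Filter.Eventually.of_forall fun η hη => ?_)
    rw [← integral_indicator (measurableSet_sublevel m _)]
    have hA : 0 < √m₀ * area (η / m₀) / √m :=
      div_pos (mul_pos hr₀ (area_pos (by rw [lt_div_iff₀ hm₀]; linarith))) hr
    congr 1
    funext p
    have hiff : sublevelArea (cosPotential m) (energy (cosPotential m) p) < √m₀ * area (η / m₀) ↔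
        energy (cosPotential m) p < m * energyOfArea (√m₀ * area (η / m₀) / √m) := by
      rw [sublevelArea_eq hm, ← lt_div_iff₀' hr, area_lt_iff hA, div_lt_iff₀' hm]
    simp only [hK, layerSet, Set.indicator_apply, Set.mem_ofPred_eq, hiff]
  refine ⟨hKi.integral_prod_right.congr hin, ?_⟩
  rw [← integral_congr_ae hin, ← integral_integral_swap hKi]
  exact integral_congr_ae (Filter.Eventually.of_forall fun p =>
    (hF.integral_indicator_layer m (g p) p).symm)

lemma ae_area_pos : ∀ᵐ η ∂profileMeasure F eStar m₀, 0 < √m₀ * area (η / m₀) :=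
  ae_profileMeasure (Filter.Eventually.of_forall fun η hη =>
    mul_pos (Real.sqrt_pos.2 hF.m₀_pos)
      (area_pos (by rw [lt_div_iff₀ hF.m₀_pos]; linarith)))

lemma reducedEnergy_eq {m : ℝ} (hm : 0 < m) :
    Integrable (fun η => energyProfile (√m₀ * area (η / m₀)) m) (profileMeasure F eStar m₀) ∧
      reducedEnergy (steadyState F m₀) m =
        m ^ 2 / 2 + ∫ η, energyProfile (√m₀ * area (η / m₀)) m ∂profileMeasure F eStar m₀ := by
  obtain ⟨h1, h2⟩ := hF.layer_cake hm (measurable_energy m) _ (abs_energy_le m)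
  have hae : ∀ᵐ η ∂profileMeasure F eStar m₀, ∫ p in {p | energy (cosPotential m) p <
      m * energyOfArea (√m₀ * area (η / m₀) / √m)}, energy (cosPotential m) p ∂phase =
      energyProfile (√m₀ * area (η / m₀)) m := by
    filter_upwards [hF.ae_area_pos] with η hη using setIntegral_energy_sublevel hm hη.le
  refine ⟨h1.congr hae, ?_⟩
  rw [← integral_congr_ae hae, ← h2]
  rfl

lemma cosMoment_eq {m : ℝ} (hm : 0 < m) :
    Integrable (fun η => cosProfile (√m₀ * area (η / m₀)) m) (profileMeasure F eStar m₀) ∧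
      ∫ p, Real.cos p.1 * rearrangement (steadyState F m₀) (cosPotential m) p ∂phase =
        ∫ η, cosProfile (√m₀ * area (η / m₀)) m ∂profileMeasure F eStar m₀ := by
  have h := hF.layer_cake hm (g := fun p => Real.cos p.1) (by fun_prop) 1 fun p => by
    have := Real.abs_cos_le_one p.1
    nlinarith [sq_nonneg p.2]
  simpa only [setIntegral_cos_sublevel hm] using h

/-- This is the layer cake with weight `1`; it supplies the dominating function for the first
derivative. -/
lemma integrable_area :
    Integrable (fun η => √m₀ * area (η / m₀)) (profileMeasure F eStar m₀) := by
  have hm := hF.m₀_pos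
  have hr := Real.sqrt_pos.2 hm
  have h := (hF.layer_cake hm (g := fun _ => 1) measurable_const 1 fun p => by
    rw [abs_one]; nlinarith [sq_nonneg p.2]).1
  refine h.congr ?_
  refine ae_profileMeasure (Filter.Eventually.of_forall fun η hη => ?_)
  have hx : -1 < η / m₀ := by rw [lt_div_iff₀ hm]; linarith
  simp only
  rw [setIntegral_one_sublevel hm, mul_div_cancel_left₀ _ hr.ne', energyOfArea_area hx.le,
    mul_div_cancel_left₀ _ hm.ne']

/-- At `m₀` the rearrangement is `f₀` itself, and self-consistency at `θ = 0` evaluates its cosine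
moment. -/
lemma integral_cosProfile_self :
    ∫ η, cosProfile (√m₀ * area (η / m₀)) m₀ ∂profileMeasure F eStar m₀ = m₀ := by
  have hm := hF.m₀_pos
  have hi := hF.integrable_mul_rearrangement m₀ (g := fun p => Real.cos p.1) (by fun_prop) 1
    fun p => by
      have := Real.abs_cos_le_one p.1
      nlinarith [sq_nonneg p.2]
  have h0 := hF.self_consistent 0
  rw [← (hF.cosMoment_eq hm).2]
  simp only [hF.rearrangement_self] at hi ⊢
  unfold phase at hi ⊢
  rw [integral_prod _ hi]
  simp only [potential, cosPotential, Real.cos_zero, mul_one, neg_inj, zero_sub,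
    Real.cos_neg] at h0
  refine Eq.trans ?_ h0
  refine setIntegral_congr_fun measurableSet_Icc fun θ _ => ?_
  simp only [density]
  rw [integral_const_mul, mul_comm]

lemma hasDerivAt_reducedEnergy {m : ℝ} (hm : 0 < m) :
    HasDerivAt (reducedEnergy (steadyState F m₀))
      (m - ∫ η, cosProfile (√m₀ * area (η / m₀)) m ∂profileMeasure F eStar m₀) m := by
  have hnear : Set.Ioi (0 : ℝ) ∈ nhds m := Ioi_mem_nhds hm
  have h := (hasDerivAt_integral_of_dominated_loc_of_deriv_le (s := Set.Ioi 0)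
    (μ := profileMeasure F eStar m₀) (bound := fun η => √m₀ * area (η / m₀))
    (F := fun m η => energyProfile (√m₀ * area (η / m₀)) m)
    (F' := fun m η => -cosProfile (√m₀ * area (η / m₀)) m) (x₀ := m) hnear ?_
    (hF.reducedEnergy_eq hm).1 (hF.cosMoment_eq hm).1.neg.aestronglyMeasurable ?_
    hF.integrable_area ?_).2
  · rw [integral_neg] at h
    have h2 := ((hasDerivAt_pow 2 m).div_const 2).add h
    refine (h2.congr_of_eventuallyEq ?_).congr_deriv (by push_cast; ring)
    filter_upwards [hnear] with x hx using (hF.reducedEnergy_eq hx).2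
  · filter_upwards [hnear] with x hx using (hF.reducedEnergy_eq hx).1.aestronglyMeasurable
  · filter_upwards [hF.ae_area_pos] with η hη x hx
    rw [norm_neg]
    exact abs_cosProfile_le hη.le hx
  · filter_upwards [hF.ae_area_pos] with η hη x hx using hasDerivAt_energyProfile hη.le hx

lemma ae_ne_m₀ : ∀ᵐ η ∂profileMeasure F eStar m₀, -1 < η / m₀ ∧ η / m₀ ≠ 1 := by
  refine ae_profileMeasure ?_
  filter_upwards [Measure.ae_ne volume m₀] with η hη h
  have hm := hF.m₀_pos
  refine ⟨by rw [lt_div_iff₀ hm]; linarith, fun h' => hη ?_⟩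
  rwa [div_eq_one_iff_eq hm.ne'] at h'

end IsSteadyState

lemma measurable_weightedPeriod {h : ℝ → ℝ} (hh : Continuous h) : Measurable (weightedPeriod h) := by
  unfold weightedPeriod
  simp only [intervalIntegral.integral_of_le (by positivity : 0 ≤ 2 * Real.pi)]
  have hm : Measurable (Function.uncurry fun x θ => h θ * (2 / speed x θ)) :=
    (hh.measurable.comp measurable_snd).mul (measurable_const.div measurable_speed)
  exact (hm.stronglyMeasurable.integral_prod_right).measurable

lemma measurable_period : Measurable period := measurable_weightedPeriod continuous_const

lemma measurable_cosPeriod : Measurable cosPeriod := measurable_weightedPeriod Real.continuous_cos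

lemma measurable_cosVariance : Measurable cosVariance :=
  (measurable_weightedPeriod (Real.continuous_cos.pow 2)).sub
    ((measurable_cosPeriod.pow_const 2).div measurable_period)

namespace IsSteadyState

variable {F : ℝ → ℝ} {eStar : EReal} {m₀ : ℝ} (hF : IsSteadyState F eStar m₀)
include hF

/-- The Lipschitz bound is constant in `η` and `μ` is finite, so domination holds; pointwise
differentiability fails to be known only at the null energy `η = m₀`. -/
lemma hasDerivAt_integral_cosProfile :
    HasDerivAt (fun m => ∫ η, cosProfile (√m₀ * area (η / m₀)) m ∂profileMeasure F eStar m₀)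
      (∫ η, cosVariance (η / m₀) / √m₀ ∂profileMeasure F eStar m₀) m₀ := by
  have hm := hF.m₀_pos
  have hr := Real.sqrt_pos.2 hm
  have hnear : Set.Ioi (m₀ / 2) ∈ nhds m₀ := Ioi_mem_nhds (by linarith)
  have := hF.isFiniteMeasure_profileMeasure
  refine (hasDerivAt_integral_of_dominated_loc_of_lip (s := Set.Ioi (m₀ / 2))
    (μ := profileMeasure F eStar m₀) (bound := fun _ => 8 * Real.pi / √(m₀ / 2))
    (F := fun m η => cosProfile (√m₀ * area (η / m₀)) m) hnear ?_
    (hF.cosMoment_eq hm).1 ?_ ?_ (integrable_const _) ?_).2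
  · filter_upwards [hnear] with x hx using
      (hF.cosMoment_eq ((half_pos hm).trans hx)).1.aestronglyMeasurable
  · exact ((measurable_cosVariance.comp
      (measurable_id.div_const m₀)).div_const √m₀).aestronglyMeasurable
  · filter_upwards [hF.ae_area_pos] with η hη using
      lipschitzOnWith_cosProfile hη (half_pos hm)
  · filter_upwards [hF.ae_area_pos, hF.ae_ne_m₀] with η hη hne
    have he : √m₀ * area (η / m₀) / √m₀ = area (η / m₀) := mul_div_cancel_left₀ _ hr.ne'
    have h := hasDerivAt_cosProfile hη hm (by
      rw [he]
      intro h
      exact hne.2 (by rw [← energyOfArea_area hne.1.le, h, energyOfArea_area (by norm_num)]))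
    rwa [he, energyOfArea_area hne.1.le] at h

end IsSteadyState


/-! ### Identification of `κ₀` -/

/-- On the well, `e - φ = (m / 2) speed²`. The resulting constant cancels in the quotient
`cosDeviation`. -/
lemma setIntegral_accessible {m : ℝ} (hm : 0 < m) (h : ℝ → ℝ) (e : ℝ) :
    ∫ θ in accessible (cosPotential m) e, h θ * (e - cosPotential m θ) ^ (-(1 / 2) : ℝ) =
      1 / (2 * √(m / 2)) * ∫ θ in (0 : ℝ)..(2 * Real.pi), h θ * (2 / speed (e / m) θ) := by
  have hset : accessible (cosPotential m) e =
      Set.Icc 0 (2 * Real.pi) ∩ {θ | 0 < e / m + Real.cos θ} := by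
    ext θ
    have : cosPotential m θ < e ↔ 0 < e / m + Real.cos θ := by
      rw [cosPotential, ← neg_lt_iff_pos_add, lt_div_iff₀ hm]
      constructor <;> intro h <;> linarith
    simp only [accessible, Set.mem_ofPred_eq, Set.mem_inter_iff, this]
  have hms := measurableSet_accessible (e / m)
  rw [hset, ← setIntegral_indicator hms, intervalIntegral.integral_of_le (by positivity),
    ← integral_Icc_eq_integral_Ioc, ← integral_const_mul]
  refine setIntegral_congr_fun measurableSet_Icc fun θ _ => ?_
  by_cases hθ : 0 < e / m + Real.cos θ
  · simp only [Set.indicator_of_mem (show θ ∈ {θ | 0 < e / m + Real.cos θ} from hθ)]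
    have hs := speed_pos hθ
    have hr : 0 < √(m / 2) := Real.sqrt_pos.2 (by linarith)
    have h1 : e - cosPotential m θ = m / 2 * (2 * (e / m + Real.cos θ)) := by
      rw [cosPotential]; field_simp; ring
    rw [h1, Real.rpow_neg (by positivity), ← Real.sqrt_eq_rpow, Real.sqrt_mul (by positivity),
      ← speed]
    field_simp
  · simp only [Set.indicator_of_notMem (show θ ∉ {θ | 0 < e / m + Real.cos θ} from hθ)]
    rw [speed_eq_zero (not_lt.1 hθ)]
    simp

lemma cosDeviation_eq {m : ℝ} (hm : 0 < m) (θ : ℝ) {e : ℝ} (h0 : -1 < e / m) (h1 : e / m ≠ 1) :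
    cosDeviation (cosPotential m) θ e =
      Real.cos θ - cosPeriod (e / m) / period (e / m) := by
  have hr : √(m / 2) ≠ 0 := (Real.sqrt_pos.2 (by linarith)).ne'
  have hp := (period_pos h0 h1).ne'
  have hden := setIntegral_accessible hm (fun _ => 1) e
  have hnum : ∫ θ' in (0 : ℝ)..(2 * Real.pi), (Real.cos θ - Real.cos θ') * (2 / speed (e / m) θ') =
      Real.cos θ * period (e / m) - cosPeriod (e / m) := by
    unfold period cosPeriod weightedPeriod
    rw [← intervalIntegral.integral_const_mul, ← intervalIntegral.integral_sub
      ((intervalIntegrable_one_period h0 h1).const_mul _) (intervalIntegrable_cos_period h0 h1)]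
    refine intervalIntegral.integral_congr fun θ' _ => ?_
    ring
  simp only [one_mul] at hden
  rw [cosDeviation, setIntegral_accessible hm, hden, hnum]
  have : ∫ θ in (0 : ℝ)..(2 * Real.pi), 2 / speed (e / m) θ = period (e / m) := by
    simp [period, weightedPeriod]
  rw [this]
  field_simp

/-- The half-lines `v > 0` and `v < 0` contribute equally, whence the `2`. For `η ≤ φ` the square
root is zero and division by zero removes the integrand, so no indicator is needed. -/
lemma lintegral_comp_kinetic (φ : ℝ) (Φ : ℝ → ENNReal) :
    ∫⁻ v : ℝ, Φ (v ^ 2 / 2 + φ) = ∫⁻ η : ℝ, Φ η * ENNReal.ofReal (2 / √(2 * (η - φ))) := by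
  have hderiv : ∀ v : ℝ, HasDerivAt (fun v : ℝ => v ^ 2 / 2 + φ) v v := fun v => by
    have h := ((hasDerivAt_pow 2 v).div_const 2).add_const φ
    refine h.congr_deriv ?_
    push_cast; ring
  have hval : ∀ v : ℝ, v ≠ 0 → ENNReal.ofReal |v| * (Φ (v ^ 2 / 2 + φ) *
      ENNReal.ofReal (1 / √(2 * (v ^ 2 / 2 + φ - φ)))) = Φ (v ^ 2 / 2 + φ) := fun v hv => by
    rw [show 2 * (v ^ 2 / 2 + φ - φ) = v ^ 2 by ring, Real.sqrt_sq_eq_abs, mul_left_comm,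
      ← ENNReal.ofReal_mul (abs_nonneg v), mul_one_div, div_self (abs_ne_zero.2 hv)]
    simp
  have himg1 : (fun v : ℝ => v ^ 2 / 2 + φ) '' Set.Ioi 0 = Set.Ioi φ := by
    ext η
    constructor
    · rintro ⟨v, hv, rfl⟩
      have : 0 < v ^ 2 := pow_pos hv 2
      simp only [Set.mem_Ioi]; linarith
    · intro h
      have h' : 0 < 2 * (η - φ) := by linarith [Set.mem_Ioi.1 h]
      exact ⟨√(2 * (η - φ)), Real.sqrt_pos.2 h', by simp only [Real.sq_sqrt h'.le]; ring⟩
  have himg2 : (fun v : ℝ => v ^ 2 / 2 + φ) '' Set.Iio 0 = Set.Ioi φ := by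
    rw [← himg1]
    ext η
    constructor
    · rintro ⟨v, hv, rfl⟩
      exact ⟨-v, Set.mem_Ioi.2 (neg_pos.2 (Set.mem_Iio.1 hv)), by simp⟩
    · rintro ⟨v, hv, rfl⟩
      exact ⟨-v, Set.mem_Iio.2 (neg_neg_of_pos (Set.mem_Ioi.1 hv)), by simp⟩
  have hinj1 : Set.InjOn (fun v : ℝ => v ^ 2 / 2 + φ) (Set.Ioi 0) := by
    intro a ha b hb hab
    have : a ^ 2 = b ^ 2 := by simp only at hab; linarith
    exact (pow_left_inj₀ (le_of_lt ha) (le_of_lt hb) two_ne_zero).1 this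
  have hinj2 : Set.InjOn (fun v : ℝ => v ^ 2 / 2 + φ) (Set.Iio 0) := by
    intro a ha b hb hab
    have h2 : (-a) ^ 2 = (-b) ^ 2 := by simp only at hab; linarith
    have := (pow_left_inj₀ (neg_nonneg.2 (le_of_lt ha)) (neg_nonneg.2 (le_of_lt hb))
      two_ne_zero).1 h2
    linarith
  have hpos : ∫⁻ v in Set.Ioi (0 : ℝ), Φ (v ^ 2 / 2 + φ) =
      ∫⁻ η in Set.Ioi φ, Φ η * ENNReal.ofReal (1 / √(2 * (η - φ))) := by
    rw [← himg1, lintegral_image_eq_lintegral_abs_deriv_mul measurableSet_Ioi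
      (fun v _ => (hderiv v).hasDerivWithinAt) hinj1]
    exact setLIntegral_congr_fun measurableSet_Ioi fun v hv => (hval v (ne_of_gt hv)).symm
  have hneg : ∫⁻ v in Set.Iio (0 : ℝ), Φ (v ^ 2 / 2 + φ) =
      ∫⁻ η in Set.Ioi φ, Φ η * ENNReal.ofReal (1 / √(2 * (η - φ))) := by
    rw [← himg2, lintegral_image_eq_lintegral_abs_deriv_mul measurableSet_Iio
      (fun v _ => (hderiv v).hasDerivWithinAt) hinj2]
    exact setLIntegral_congr_fun measurableSet_Iio fun v hv => (hval v (ne_of_lt hv)).symm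
  have hsplit : ∫⁻ v : ℝ, Φ (v ^ 2 / 2 + φ) =
      (∫⁻ v in Set.Iio (0 : ℝ), Φ (v ^ 2 / 2 + φ)) + ∫⁻ v in Set.Ioi (0 : ℝ), Φ (v ^ 2 / 2 + φ) := by
    rw [← lintegral_add_compl _ (measurableSet_Iio (a := (0 : ℝ))), Set.compl_Iio,
      setLIntegral_congr Ioi_ae_eq_Ici.symm]
  have hind : ∀ η, Φ η * ENNReal.ofReal (2 / √(2 * (η - φ))) =
      Set.indicator (Set.Ioi φ) (fun η => 2 * (Φ η * ENNReal.ofReal (1 / √(2 * (η - φ))))) η := by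
    intro η
    by_cases h : η ∈ Set.Ioi φ
    · rw [Set.indicator_of_mem h, mul_left_comm,
        show (2 : ENNReal) = ENNReal.ofReal 2 by simp, ← ENNReal.ofReal_mul zero_le_two,
        mul_one_div]
    · rw [Set.indicator_of_notMem h, Real.sqrt_eq_zero_of_nonpos
        (by linarith [not_lt.1 (fun h' => h (Set.mem_Ioi.2 h'))])]
      simp
  rw [hsplit, hneg, hpos, lintegral_congr hind, lintegral_indicator measurableSet_Ioi,
    lintegral_const_mul' _ _ (by simp), two_mul]

lemma sqrt_kinetic {m : ℝ} (hm : 0 < m) (η θ : ℝ) :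
    √(2 * (η - cosPotential m θ)) = √m * speed (η / m) θ := by
  rw [speed, ← Real.sqrt_mul hm.le, cosPotential]
  congr 1
  field_simp
  ring

/-- On each fibre, energies not above `-1` force `v = 0`, and the separatrix allows at most two
velocities. -/
lemma ae_phase_energy {m : ℝ} (hm : 0 < m) : ∀ᵐ p ∂phase,
    -1 < energy (cosPotential m) p / m ∧ energy (cosPotential m) p / m ≠ 1 := by
  have hms : MeasurableSet {p : ℝ × ℝ | -1 < energy (cosPotential m) p / m ∧
      energy (cosPotential m) p / m ≠ 1} :=
    (measurableSet_lt measurable_const ((measurable_energy m).div_const m)).inter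
      (measurableSet_eq_fun ((measurable_energy m).div_const m) measurable_const).compl
  unfold phase
  refine (Measure.ae_prod_iff_ae_ae hms).2 (Filter.Eventually.of_forall fun θ => ?_)
  set a := √(2 * (m + m * Real.cos θ))
  filter_upwards [Measure.ae_ne volume 0, Measure.ae_ne volume a, Measure.ae_ne volume (-a)]
    with v h0 h1 h2
  have hv : 0 < v ^ 2 := by positivity
  constructor
  · rw [lt_div_iff₀ hm, energy, cosPotential]
    nlinarith [Real.cos_le_one θ]
  · intro h
    rw [div_eq_one_iff_eq hm.ne', energy, cosPotential] at h
    have ha : v ^ 2 = a ^ 2 := by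
      rw [Real.sq_sqrt (by nlinarith [Real.neg_one_le_cos θ])]
      simp only at h
      linarith
    rcases sq_eq_sq_iff_eq_or_eq_neg.1 ha with h | h
    exacts [h1 h, h2 h]

/-- The squared deviation of `cos θ` from its mean over the level set of energy `η`. -/
noncomputable def sqDeviation (m θ η : ℝ) : ℝ :=
  (Real.cos θ - cosPeriod (η / m) / period (η / m)) ^ 2

lemma measurable_sqDeviation (m : ℝ) : Measurable fun q : ℝ × ℝ => sqDeviation m q.1 q.2 := by
  unfold sqDeviation
  have h : Measurable fun η : ℝ => cosPeriod (η / m) / period (η / m) :=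
    (measurable_cosPeriod.comp (measurable_id.div_const m)).div
      (measurable_period.comp (measurable_id.div_const m))
  exact ((Real.measurable_cos.comp measurable_fst).sub (h.comp measurable_snd)).pow_const 2

lemma lintegral_sqDeviation {m : ℝ} (hm : 0 < m) {η : ℝ} (h0 : -1 < η / m) (h1 : η / m ≠ 1) :
    ∫⁻ θ in Set.Icc 0 (2 * Real.pi), ENNReal.ofReal (sqDeviation m θ η) *
      ENNReal.ofReal (2 / (√m * speed (η / m) θ)) = ENNReal.ofReal (cosVariance (η / m) / √m) := by
  have hr := Real.sqrt_pos.2 hm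
  have hpi : 0 ≤ 2 * Real.pi := by positivity
  have hint : IntervalIntegrable (fun θ => sqDeviation m θ η * (2 / speed (η / m) θ))
      volume 0 (2 * Real.pi) :=
    intervalIntegrable_period (g := fun c => (c - cosPeriod (η / m) / period (η / m)) ^ 2)
      (by fun_prop) h0 h1 _ _
  have hV : ∫ θ in (0 : ℝ)..(2 * Real.pi), sqDeviation m θ η * (2 / speed (η / m) θ) =
      cosVariance (η / m) := integral_cos_sub_mean_sq h0 h1
  rw [div_eq_mul_inv (cosVariance _), mul_comm (cosVariance _), ← hV, ← intervalIntegral.integral_const_mul,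
    intervalIntegral.integral_of_le hpi, ← integral_Icc_eq_integral_Ioc,
    ofReal_integral_eq_lintegral_ofReal]
  · refine lintegral_congr fun θ => ?_
    rw [← ENNReal.ofReal_mul (show 0 ≤ sqDeviation m θ η from sq_nonneg _)]
    congr 1
    rw [div_mul_eq_div_div_swap]
    ring
  · rw [← IntegrableOn, integrableOn_Icc_iff_integrableOn_Ioc,
      ← intervalIntegrable_iff_integrableOn_Ioc_of_le hpi]
    exact hint.const_mul _
  · refine Filter.Eventually.of_forall fun θ => ?_
    have := speed_nonneg (η / m) θ
    have : 0 ≤ sqDeviation m θ η := sq_nonneg _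
    positivity

/-- Replacing `v` by the energy and exchanging integrals leaves, at each energy, the squared
deviation of `cos θ` integrated over the level set, which is its variance. -/
lemma kappa_eq_lintegral (F : ℝ → ℝ) {m : ℝ} (hm : 0 < m) :
    kappa F m = ∫⁻ η in Set.Ioi (-m),
      ENNReal.ofReal |deriv F η| * ENNReal.ofReal (cosVariance (η / m) / √m) := by
  have hmF : Measurable fun η => |deriv F η| := (measurable_deriv F).abs
  have h1 : kappa F m = ∫⁻ p, ENNReal.ofReal (|deriv F (energy (cosPotential m) p)| *
      sqDeviation m p.1 (energy (cosPotential m) p)) ∂phase := by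
    refine lintegral_congr_ae ?_
    filter_upwards [ae_phase_energy hm] with p hp
    rw [cosDeviation_eq hm _ hp.1 hp.2, sqDeviation]
  have hmeas1 : Measurable fun p : ℝ × ℝ =>
      ENNReal.ofReal (|deriv F (energy (cosPotential m) p)| *
      sqDeviation m p.1 (energy (cosPotential m) p)) :=
    ((hmF.comp (measurable_energy m)).mul ((measurable_sqDeviation m).comp
      (measurable_fst.prodMk (measurable_energy m)))).ennreal_ofReal
  have hmeas2 : Measurable (Function.uncurry fun θ η : ℝ =>
      ENNReal.ofReal (|deriv F η| * sqDeviation m θ η) *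
        ENNReal.ofReal (2 / (√m * speed (η / m) θ))) := by
    refine ((hmF.comp measurable_snd).mul (measurable_sqDeviation m)).ennreal_ofReal.mul ?_
    refine (measurable_const.div (measurable_const.mul ?_)).ennreal_ofReal
    exact measurable_speed.comp ((measurable_snd.div_const m).prodMk measurable_fst)
  rw [h1, phase, lintegral_prod _ hmeas1.aemeasurable]
  have h2 : ∀ θ : ℝ, ∫⁻ v, ENNReal.ofReal (|deriv F (energy (cosPotential m) (θ, v))| *
      sqDeviation m θ (energy (cosPotential m) (θ, v))) =
      ∫⁻ η, ENNReal.ofReal (|deriv F η| * sqDeviation m θ η) *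
        ENNReal.ofReal (2 / (√m * speed (η / m) θ)) := by
    intro θ
    have := lintegral_comp_kinetic (cosPotential m θ)
      (fun η => ENNReal.ofReal (|deriv F η| * sqDeviation m θ η))
    simp only [sqrt_kinetic hm] at this
    exact this
  rw [lintegral_congr h2, lintegral_lintegral_swap hmeas2.aemeasurable,
    ← lintegral_indicator measurableSet_Ioi]
  refine lintegral_congr_ae ?_
  filter_upwards [Measure.ae_ne volume m] with η hη
  by_cases h : η ∈ Set.Ioi (-m)
  · have h0 : -1 < η / m := by rw [lt_div_iff₀ hm]; linarith [Set.mem_Ioi.1 h]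
    have h1 : η / m ≠ 1 := by rwa [Ne, div_eq_one_iff_eq hm.ne']
    rw [Set.indicator_of_mem h, ← lintegral_sqDeviation hm h0 h1,
      ← lintegral_const_mul' _ _ ENNReal.ofReal_ne_top]
    refine lintegral_congr fun θ => ?_
    rw [ENNReal.ofReal_mul (abs_nonneg _), mul_assoc]
  · have h' : η / m ≤ -1 := by rw [div_le_iff₀ hm]; linarith [not_lt.1 fun h' => h (Set.mem_Ioi.2 h')]
    rw [Set.indicator_of_notMem h]
    have : ∀ θ, speed (η / m) θ = 0 := fun θ => speed_eq_zero (by linarith [Real.cos_le_one θ])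
    simp [this]

namespace IsSteadyState

variable {F : ℝ → ℝ} {eStar : EReal} {m₀ : ℝ} (hF : IsSteadyState F eStar m₀)
include hF

lemma ae_deriv_eq_zero : ∀ᵐ η : ℝ, eStar ≤ (η : EReal) → deriv F η = 0 := by
  induction eStar using EReal.rec with
  | bot => exact absurd rfl hF.eStar_ne_bot
  | top => exact Filter.Eventually.of_forall fun η h => absurd h (not_le.2 (EReal.coe_lt_top η))
  | coe c =>
    filter_upwards [Measure.ae_ne volume c] with η hη h
    have hlt : c < η := lt_of_le_of_ne (EReal.coe_le_coe_iff.1 h) hη.symm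
    have hev : F =ᶠ[nhds η] fun _ => 0 := by
      filter_upwards [lt_mem_nhds hlt] with y hy
      exact hF.eq_zero y (EReal.coe_le_coe_iff.2 (le_of_lt hy))
    rw [hev.deriv_eq, deriv_const]

lemma kappa_eq :
    kappa F m₀ = ∫⁻ η, ENNReal.ofReal (cosVariance (η / m₀) / √m₀) ∂profileMeasure F eStar m₀ := by
  have hm := hF.m₀_pos
  have hV : Measurable fun η => ENNReal.ofReal (cosVariance (η / m₀) / √m₀) :=
    ((measurable_cosVariance.comp (measurable_id.div_const m₀)).div_const √m₀).ennreal_ofReal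
  have hF' : Measurable fun η => ENNReal.ofReal (-deriv F η) :=
    (measurable_deriv F).neg.ennreal_ofReal
  have hS := (measurableSet_Ioi (a := -m₀)).inter (measurableSet_lt_eStar eStar)
  rw [kappa_eq_lintegral F hm, profileMeasure, lintegral_withDensity_eq_lintegral_mul _
    hF' hV, ← lintegral_indicator measurableSet_Ioi,
    ← lintegral_indicator hS]
  refine lintegral_congr_ae ?_
  filter_upwards [hF.ae_deriv_eq_zero] with η hη
  by_cases h1 : η ∈ Set.Ioi (-m₀)
  · by_cases h2 : (η : EReal) < eStar
    · rw [Set.indicator_of_mem h1, Set.indicator_of_mem (Set.mem_inter h1 h2),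
        abs_of_neg (hF.deriv_neg η h2)]
      rfl
    · rw [Set.indicator_of_mem h1, Set.indicator_of_notMem fun h => h2 h.2, hη (not_lt.1 h2)]
      simp
  · rw [Set.indicator_of_notMem h1, Set.indicator_of_notMem fun h => h1 h.1]

lemma kappa_toReal :
    (kappa F m₀).toReal = ∫ η, cosVariance (η / m₀) / √m₀ ∂profileMeasure F eStar m₀ := by
  rw [hF.kappa_eq, integral_eq_lintegral_of_nonneg_ae]
  · filter_upwards [hF.ae_ne_m₀] with η hη
    exact div_nonneg (cosVariance_nonneg hη.1 hη.2) (Real.sqrt_nonneg _)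
  · exact ((measurable_cosVariance.comp
      (measurable_id.div_const m₀)).div_const √m₀).aestronglyMeasurable

lemma hasDerivAt_deriv_reducedEnergy :
    HasDerivAt (deriv (reducedEnergy (steadyState F m₀))) (1 - (kappa F m₀).toReal) m₀ := by
  rw [hF.kappa_toReal]
  refine ((hasDerivAt_id m₀).sub hF.hasDerivAt_integral_cosProfile).congr_of_eventuallyEq ?_
  filter_upwards [lt_mem_nhds hF.m₀_pos] with m hm using (hF.hasDerivAt_reducedEnergy hm).deriv

end IsSteadyState

/-! ### Second derivative test and conclusion -/

/-- A strict version of the second derivative test. -/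
lemma eventually_lt_of_deriv_deriv_pos {f : ℝ → ℝ} {x c : ℝ}
    (hf : ∀ᶠ y in nhds x, DifferentiableAt ℝ f y) (h1 : HasDerivAt f 0 x)
    (h2 : HasDerivAt (deriv f) c x) (hc : 0 < c) :
    ∀ᶠ y in nhdsWithin x {x}ᶜ, f x < f y := by
  -- Since `deriv f` vanishes at `x`, a positive slope gives `deriv f y` the sign of `y - x`, so `f`
  -- is strictly monotone on each side.
  have hslope : ∀ᶠ y in nhdsWithin x {x}ᶜ, 0 < slope (deriv f) x y :=
    (hasDerivAt_iff_tendsto_slope.1 h2).eventually (lt_mem_nhds hc)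
  obtain ⟨ε, hε, hball⟩ := Metric.eventually_nhds_iff_ball.1
    (hf.and (eventually_nhdsWithin_iff.1 hslope))
  rw [eventually_nhdsWithin_iff]
  filter_upwards [Metric.ball_mem_nhds x hε] with y hy hne
  have hne : y ≠ x := hne
  have hsub : Set.uIcc x y ⊆ Metric.ball x ε := by
    have : Convex ℝ (Metric.ball x ε) := convex_ball x ε
    exact this.ordConnected.uIcc_subset (Metric.mem_ball_self hε) hy
  have hd : ∀ z ∈ Set.uIcc x y, DifferentiableAt ℝ f z := fun z hz => (hball z (hsub hz)).1
  have hs : ∀ z ∈ Set.uIcc x y, z ≠ x → 0 < (z - x)⁻¹ * deriv f z := fun z hz hzx => by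
    have := (hball z (hsub hz)).2 hzx
    rwa [slope_def_field, h1.deriv, sub_zero, div_eq_inv_mul] at this
  rcases lt_or_gt_of_ne hne with h | h
  · rw [Set.uIcc_of_ge h.le] at hd hs
    refine strictAntiOn_of_deriv_neg (convex_Icc y x)
      (fun z hz => (hd z hz).continuousAt.continuousWithinAt) (fun z hz => ?_)
      (Set.left_mem_Icc.2 h.le) (Set.right_mem_Icc.2 h.le) h
    rw [interior_Icc] at hz
    have := hs z (Set.Ioo_subset_Icc_self hz) hz.2.ne
    exact neg_of_mul_pos_right this (inv_nonpos.2 (by linarith [hz.2]))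
  · rw [Set.uIcc_of_le h.le] at hd hs
    refine strictMonoOn_of_deriv_pos (convex_Icc x y)
      (fun z hz => (hd z hz).continuousAt.continuousWithinAt) (fun z hz => ?_)
      (Set.left_mem_Icc.2 h.le) (Set.right_mem_Icc.2 h.le) h
    rw [interior_Icc] at hz
    have := hs z (Set.Ioo_subset_Icc_self hz) hz.1.ne'
    exact pos_of_mul_pos_right this (inv_nonneg.2 (by linarith [hz.1]))

end HMF

theorem mainTheorem3 (F : ℝ → ℝ) (eStar : EReal) (m₀ : ℝ)
    (hF : HMF.IsSteadyState F eStar m₀) (hκ : HMF.kappa F m₀ < 1) :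
    -- the reduced energy is well defined on `[0, ∞)`
    (∀ m : ℝ, 0 ≤ m →
      MeasureTheory.Integrable
        (HMF.reducedEnergyIntegrand (HMF.steadyState F m₀) m) HMF.phase) ∧
    -- `m₀` is a strict local minimizer
    (∀ᶠ m in nhdsWithin m₀ {m₀}ᶜ,
      HMF.reducedEnergy (HMF.steadyState F m₀) m₀ <
        HMF.reducedEnergy (HMF.steadyState F m₀) m) ∧
    -- `J'(m₀) = 0`
    HasDerivAt (HMF.reducedEnergy (HMF.steadyState F m₀)) 0 m₀ ∧
    -- `J` is differentiable near `m₀`, and `J''(m₀) = 1 - κ₀ > 0`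
    (∀ᶠ m in nhds m₀, DifferentiableAt ℝ (HMF.reducedEnergy (HMF.steadyState F m₀)) m) ∧
    HasDerivAt (deriv (HMF.reducedEnergy (HMF.steadyState F m₀)))
      (1 - (HMF.kappa F m₀).toReal) m₀ ∧
    0 < 1 - (HMF.kappa F m₀).toReal := by
  have hm := hF.m₀_pos
  have hdiff : ∀ᶠ m in nhds m₀,
      DifferentiableAt ℝ (HMF.reducedEnergy (HMF.steadyState F m₀)) m := by
    filter_upwards [lt_mem_nhds hm] with m hm
    exact (hF.hasDerivAt_reducedEnergy hm).differentiableAt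
  have h1 : HasDerivAt (HMF.reducedEnergy (HMF.steadyState F m₀)) 0 m₀ :=
    (hF.hasDerivAt_reducedEnergy hm).congr_deriv (by rw [hF.integral_cosProfile_self, sub_self])
  have h2 := hF.hasDerivAt_deriv_reducedEnergy
  have h3 : 0 < 1 - (HMF.kappa F m₀).toReal := by
    have := (ENNReal.toReal_lt_toReal (ne_top_of_lt hκ) ENNReal.one_ne_top).2 hκ
    rw [ENNReal.toReal_one] at this
    linarith
  exact ⟨fun m _ => hF.integrable_reducedEnergyIntegrand m,
    HMF.eventually_lt_of_deriv_deriv_pos hdiff h1 h2 h3, h1, hdiff, h2, h3⟩
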